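/- Let $n\ge 4$ and let $f:M^n\to\mathbb R^{n+1}$ be a smooth immersed hypersurface which is conformally flat (every point of $M$ has a chart in which the induced metric is $g=\mu\sum_i (dx^i)^2$ with $\mu>0$ smooth) and free of umbilical points (the second fundamental form $h$ is at no point a multiple of $g$). Then every point $p$ of $M$ at which $h$ has rank at least $2$ has an open neighbourhood $U$ in $M$ such that $f|_U$ lies on, in fact is, a piece of a canal hypersurface. In particular, if $h$ has rank at least $2$ at every point, then $M$ locally lies on a canal hypersurface. Here a hypersurface is called canal if it is a smooth one-parameter family of spherical generators, i.e. of (open pieces of) spheres $S^{n-1}(s)$ of codimension two (sections of a hypersphere of $\mathbb R^{n+1}$ by a hyperplane), $s$ in an open interval, such that the normals to the hypersurface at the points of any fixed generator pass through a fixed point $z(s)$. Precisely, for $f|_U$: there are an open interval $J=(a,b)$, a smooth submersion $\sigma$ of $U$ onto $J$, and smooth families $z(s),c(s),\nu(s)\in\mathbb R^{n+1}$, $r(s)>0$ with $|\nu(s)|=1$ ($s\in J$), such that for every $q\in U$ with $\sigma(q)=s$ the point $f(q)$ lies on the sphere $S^{n-1}(s)=\{x : |x-c(s)|=r(s),\ \langle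 x-c(s),\nu(s)\rangle=0\}$ and the vector $f(q)-z(s)$ is orthogonal to $df(T_qM)$. -/

import Mathlib

open Set
open scoped Manifold ContDiff

noncomputable section

namespace CanalHypersurface

variable {n : ℕ} {M : Type*} [TopologicalSpace M] [ChartedSpace (EuclideanSpace ℝ (Fin n)) M]

/-- The differential `df_p : T_pM → ℝᵏ` of a map `f : M → ℝᵏ`. -/
def differential {k : ℕ} (f : M → EuclideanSpace ℝ (Fin k)) (p : M) :
    TangentSpace (𝓡 n) p →L[ℝ] EuclideanSpace ℝ (Fin k) :=
  mfderiv (𝓡 n) (𝓡 k) f p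

/-- `f : Mⁿ → ℝⁿ⁺¹` is a smooth (immersed) hypersurface. -/
def IsHypersurface (f : M → EuclideanSpace ℝ (Fin (n + 1))) : Prop :=
  ContMDiff (𝓡 n) (𝓡 (n + 1)) ∞ f ∧ ∀ p : M, Function.Injective (differential (n := n) f p)

/-- The induced metric (first fundamental form) `g(v, w) = ⟨df v, df w⟩`. -/
def inducedMetric (f : M → EuclideanSpace ℝ (Fin (n + 1))) (p : M)
    (v w : TangentSpace (𝓡 n) p) : ℝ :=
  inner ℝ (differential (n := n) f p v) (differential (n := n) f p w)

/-- The hypersurface is conformally flat: around every point there is a smooth chart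
`e = (x¹, …, xⁿ)` of `M` in which the induced metric is `g = μ ∑ (dxⁱ)²` for a positive smooth
function `μ`. -/
def IsConformallyFlat (f : M → EuclideanSpace ℝ (Fin (n + 1))) : Prop :=
  ∀ p : M, ∃ e ∈ IsManifold.maximalAtlas (𝓡 n) ∞ M, p ∈ e.source ∧
    ∃ μ : M → ℝ, ContMDiffOn (𝓡 n) 𝓘(ℝ, ℝ) ∞ μ e.source ∧
      ∀ q ∈ e.source, 0 < μ q ∧ ∀ v w : TangentSpace (𝓡 n) q,
        inducedMetric f q v w =
          μ q * inner ℝ (differential (n := n) (k := n) e q v) (differential (n := n) (k := n) e q w)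

/-- `N` is a smooth unit normal field of the hypersurface on the open neighbourhood `W` of `p`. -/
def IsUnitNormalNear (f N : M → EuclideanSpace ℝ (Fin (n + 1))) (W : Set M) (p : M) : Prop :=
  IsOpen W ∧ p ∈ W ∧ ContMDiffOn (𝓡 n) (𝓡 (n + 1)) ∞ N W ∧
    ∀ q ∈ W, ‖N q‖ = 1 ∧ ∀ v : TangentSpace (𝓡 n) q, inner ℝ (N q) (differential (n := n) f q v) = 0

/-- The second fundamental form `h(v, w) = -⟨dN v, df w⟩` with respect to the unit normal `N`. -/
def secondFundamentalForm (f N : M → EuclideanSpace ℝ (Fin (n + 1))) (p : M)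
    (v w : TangentSpace (𝓡 n) p) : ℝ :=
  - inner ℝ (differential (n := n) N p v) (differential (n := n) f p w)

/-- `p` is an umbilical point: `h = c g` at `p` for some number `c`. (The unit normal near `p` is
unique up to sign, so its choice is immaterial.) -/
def IsUmbilicalPoint (f : M → EuclideanSpace ℝ (Fin (n + 1))) (p : M) : Prop :=
  ∃ (W : Set M) (N : M → EuclideanSpace ℝ (Fin (n + 1))), IsUnitNormalNear f N W p ∧
    ∃ c : ℝ, ∀ v w : TangentSpace (𝓡 n) p,
      secondFundamentalForm f N p v w = c * inducedMetric f p v w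

/-- The second fundamental form at `p` has rank at most one: `h = β η ⊗ η` at `p` for some number
`β` and some linear form `η` on `T_pM`. -/
def IsRankLeOnePoint (f : M → EuclideanSpace ℝ (Fin (n + 1))) (p : M) : Prop :=
  ∃ (W : Set M) (N : M → EuclideanSpace ℝ (Fin (n + 1))), IsUnitNormalNear f N W p ∧
    ∃ (β : ℝ) (η : TangentSpace (𝓡 n) p →ₗ[ℝ] ℝ), ∀ v w : TangentSpace (𝓡 n) p,
      secondFundamentalForm f N p v w = β * (η v * η w)

/-- The sphere of codimension two in `ℝᵐ` with centre `c` and radius `r` in the hyperplane through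
`c` orthogonal to `ν`, that is, the section of the hypersphere with centre `c` and radius `r` by
that hyperplane. -/
def codimTwoSphere {m : ℕ} (c ν : EuclideanSpace ℝ (Fin m)) (r : ℝ) :
    Set (EuclideanSpace ℝ (Fin m)) :=
  {x | ‖x - c‖ = r ∧ inner ℝ (x - c) ν = 0}

/-- The part of the hypersurface `f` over the open set `U` is a canal hypersurface: it is a smooth
one-parameter family, `s ∈ (a, b)`, of spherical generators such that the normals at the points of
any fixed generator pass through a fixed point `z s`.

The parameter `s` is given as a submersion `σ : U → (a, b)`. The generator `σ = s` is a
hypersurface of `U` that `f` maps into the sphere of codimension two with centre `c s`, radius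
`r s > 0` and axis `ν s`, hence onto an open piece of it. The point `z s` is on the normal line
at `q` iff `f q - z s` is orthogonal to the tangent hyperplane at `q`. -/
def IsCanalHypersurfaceOn (f : M → EuclideanSpace ℝ (Fin (n + 1))) (U : Set M) : Prop :=
  ∃ (a b : ℝ) (z c ν : ℝ → EuclideanSpace ℝ (Fin (n + 1))) (r : ℝ → ℝ) (σ : M → ℝ),
    ContDiffOn ℝ ∞ z (Ioo a b) ∧ ContDiffOn ℝ ∞ c (Ioo a b) ∧
    ContDiffOn ℝ ∞ ν (Ioo a b) ∧ ContDiffOn ℝ ∞ r (Ioo a b) ∧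
    (∀ s ∈ Ioo a b, ‖ν s‖ = 1 ∧ 0 < r s) ∧
    ContMDiffOn (𝓡 n) 𝓘(ℝ, ℝ) ∞ σ U ∧ σ '' U = Ioo a b ∧
    ∀ q ∈ U, mfderiv (𝓡 n) 𝓘(ℝ, ℝ) σ q ≠ 0 ∧
      f q ∈ codimTwoSphere (c (σ q)) (ν (σ q)) (r (σ q)) ∧
      ∀ v : TangentSpace (𝓡 n) q, inner ℝ (f q - z (σ q)) (differential (n := n) f q v) = 0

end CanalHypersurface

end

/-! For a conformally flat metric the curvature is determined by a symmetric bilinear form, so the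
curvature of a plane spanned by an orthonormal pair `v`, `w` is a sum `a v + a w`. By the Gauss
equation it is also `h v v * h w w - h v w ^ 2`. In an eigenbasis this reads `l i * l j = a i + a j`
for `i ≠ j`, and with at least four indices all eigenvalues but one must coincide (Cartan). Hence
the principal curvatures are `κ`, of multiplicity at least `n - 1`, and `κ + δ`. Absence of umbilics
gives `δ ≠ 0`, which makes `κ`, `δ` and a unit direction `η` of the simple curvature locally smooth
(`exists_smooth_principal`).

On the distribution orthogonal to `η` one has `dN = -κ dF`. The Codazzi equation shows that `κ` is
constant along this distribution, and that the unit tangent field `ξ` in the direction `dF η`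
satisfies `dξ = ρ dF` there. Symmetry of the second derivatives of `ξ` then makes `ρ` constant as
well. Along the leaves the vectors `N` and `ξ` thus vary by constant multiples of `dF`, so that
suitable combinations of `F`, `N` and `ξ` do not vary at all. They give the centre `c`, the axis `ν`
and the focal point `z = F + N / κ`, and the radius depends only on `κ` and `ρ`
(`IsPrincipal.exists_spheres`). Rank at least two means `κ ≠ 0`, which is needed for `z` to exist
and for the spheres to move across the leaves.

Since `c` or `ν` moves across the leaves, one of its components is a submersion `σ` whose level sets
are the leaves. Everything constant along leaves is locally a smooth function of `σ`
(`exists_factorization`), which gives the one-parameter family. All this is done in a conformal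
chart and then transported to `M`. -/

noncomputable section

namespace CanalHypersurface

/-! ### Cartan's algebraic lemma on eigenvalues -/

section Algebra

/-- If `l i * l j = a i + a j` for all `i ≠ j` among at least four indices, then all the `l i`
but one agree. -/
theorem exists_forall_ne_eq_of_mul_eq_add {ι : Type*} [Fintype ι] (hι : 4 ≤ Fintype.card ι)
    (l a : ι → ℝ) (h : ∀ i j, i ≠ j → l i * l j = a i + a j) :
    ∃ i₀ c, ∀ i, i ≠ i₀ → l i = c := by
  classical
  -- In the expansion of the product every `a` occurs twice with opposite signs. Only indices from
  -- different factors need to differ.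
  have key : ∀ i j k m, i ≠ k → i ≠ m → j ≠ k → j ≠ m →
      (l i - l j) * (l k - l m) = 0 := by
    intro i j k m h1 h2 h3 h4
    linear_combination h i k h1 - h i m h2 - h j k h3 + h j m h4
  by_cases hall : ∀ i j, l i = l j
  · have : Nonempty ι := Fintype.card_pos_iff.1 (by omega)
    obtain ⟨i⟩ := this
    exact ⟨i, l i, fun j _ => hall j i⟩
  push Not at hall
  obtain ⟨i, j, hij⟩ := hall
  have hne : i ≠ j := fun e => hij (by rw [e])
  have hc : 1 < (({i, j} : Finset ι)ᶜ).card := by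
    rw [Finset.card_compl, Finset.card_pair hne]; omega
  obtain ⟨k, hk, m, hm, hkm⟩ := Finset.one_lt_card.1 hc
  simp only [Finset.mem_compl, Finset.mem_insert, Finset.mem_singleton, not_or] at hk hm
  have hoth : ∀ q, q ≠ i → q ≠ j → l q = l k := fun q hqi hqj => by
    have := key i j q k (Ne.symm hqi) (Ne.symm hk.1) (Ne.symm hqj) (Ne.symm hk.2)
    rcases mul_eq_zero.1 this with h0 | h0
    · exact absurd (sub_eq_zero.1 h0) hij
    · exact sub_eq_zero.1 h0
  have hmk := hoth m hm.1 hm.2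
  -- All values outside `{i, j}` already agree. Pairing `i` with `k` and `j` with `m` shows that one
  -- of `i`, `j` has the common value too; this is where a fourth index is needed.
  rcases mul_eq_zero.1 (key i k j m hne (Ne.symm hm.1) hk.2 hkm) with h0 | h0
  · refine ⟨j, l k, fun q hq => ?_⟩
    by_cases hqi : q = i
    · rw [hqi]; exact sub_eq_zero.1 h0
    · exact hoth q hqi hq
  · refine ⟨i, l k, fun q hq => ?_⟩
    by_cases hqj : q = j
    · rw [hqj, ← hmk]; exact sub_eq_zero.1 h0
    · exact hoth q hq hqj

variable {E : Type*} [NormedAddCommGroup E] [InnerProductSpace ℝ E] [FiniteDimensional ℝ E]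

/-- A symmetric operator in dimension at least four whose sectional curvatures
`⟪T v, v⟫ ⟪T w, w⟫ - ⟪T v, w⟫ ^ 2` split as `a v + a w` is a multiple of the identity up to a term
of rank one. -/
theorem exists_eq_smul_add_rankOne {T : E →L[ℝ] E} (hT : (T : E →ₗ[ℝ] E).IsSymmetric)
    (hdim : 4 ≤ Module.finrank ℝ E) (a : E → ℝ)
    (h : ∀ v w : E, ‖v‖ = 1 → ‖w‖ = 1 → inner ℝ v w = 0 →
      inner ℝ (T v) v * inner ℝ (T w) w - inner ℝ (T v) w ^ 2 = a v + a w) :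
    ∃ (η : E) (l d : ℝ), ‖η‖ = 1 ∧ ∀ v, T v = l • v + (d * inner ℝ η v) • η := by
  classical
  set b := hT.eigenvectorBasis rfl with hb
  set ev := hT.eigenvalues rfl with hev
  have hTb : ∀ i, T (b i) = ev i • b i := fun i => by
    exact hT.apply_eigenvectorBasis rfl i
  have hin : ∀ i j, i ≠ j → inner ℝ (b i) (b j) = 0 := fun i j hij =>
    b.orthonormal.2 hij
  obtain ⟨i₀, c, hc⟩ := exists_forall_ne_eq_of_mul_eq_add (by simpa using hdim) ev
    (fun i => a (b i)) fun i j hij => by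
      have := h (b i) (b j) (b.orthonormal.1 i) (b.orthonormal.1 j) (hin i j hij)
      simpa [hTb, inner_smul_left, hin i j hij] using this
  refine ⟨b i₀, c, ev i₀ - c, b.orthonormal.1 i₀, fun v => ?_⟩
  have : (T : E →ₗ[ℝ] E) =
      c • LinearMap.id + (ev i₀ - c) • ((innerₛₗ ℝ (b i₀)).smulRight (b i₀)) := by
    refine b.toBasis.ext fun i => ?_
    by_cases hi : i = i₀
    · subst hi
      simp [hTb, ← add_smul]
    · simp [hTb, hc i hi, hin i₀ i (Ne.symm hi)]
  have := LinearMap.congr_fun this v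
  simpa [mul_smul] using this

end Algebra

/-! ### Calculus of directional derivatives on open sets -/

section DirDeriv

variable {E G : Type*} [NormedAddCommGroup E] [NormedSpace ℝ E]

/-- The directional derivative `∂_v g`, as an operator on functions. -/
def dirDeriv [NormedAddCommGroup G] [NormedSpace ℝ G] (v : E) (g : E → G) : E → G :=
  fun x => fderiv ℝ g x v

section
variable [NormedAddCommGroup G] [NormedSpace ℝ G] {Ω : Set E} {g k : E → G} {x : E}

theorem differentiableAt_of_contDiffOn (hΩ : IsOpen Ω) (hg : ContDiffOn ℝ ∞ g Ω) (hx : x ∈ Ω) :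
    DifferentiableAt ℝ g x :=
  (hg.contDiffAt (hΩ.mem_nhds hx)).differentiableAt (by simp)

theorem contDiffOn_dirDeriv (hΩ : IsOpen Ω) (hg : ContDiffOn ℝ ∞ g Ω) (v : E) :
    ContDiffOn ℝ ∞ (dirDeriv v g) Ω :=
  (hg.fderiv_of_isOpen hΩ (m := ∞) (by simp)).clm_apply contDiffOn_const

theorem dirDeriv_congr (hΩ : IsOpen Ω) (h : EqOn g k Ω) (v : E) (hx : x ∈ Ω) :
    dirDeriv v g x = dirDeriv v k x := by
  unfold dirDeriv
  rw [(h.eventuallyEq_of_mem (hΩ.mem_nhds hx)).fderiv_eq]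

theorem dirDeriv_comm (hΩ : IsOpen Ω) (hg : ContDiffOn ℝ ∞ g Ω) (v w : E) (hx : x ∈ Ω) :
    dirDeriv v (dirDeriv w g) x = dirDeriv w (dirDeriv v g) x := by
  have hd : DifferentiableAt ℝ (fderiv ℝ g) x :=
    differentiableAt_of_contDiffOn hΩ (hg.fderiv_of_isOpen hΩ (m := ∞) (by simp)) hx
  have key : ∀ u s, dirDeriv u (dirDeriv s g) x = fderiv ℝ (fderiv ℝ g) x u s := fun u s => by
    change fderiv ℝ (fun y => fderiv ℝ g y s) x u = _
    rw [fderiv_clm_apply hd (differentiableAt_const s)]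
    simp
  rw [key, key]
  exact ((hg.contDiffAt (hΩ.mem_nhds hx)).isSymmSndFDerivAt
    (by simpa using WithTop.coe_le_coe.2 (le_top : (2 : ℕ∞) ≤ ⊤))) v w

theorem dirDeriv_smul {c : E → ℝ} (hΩ : IsOpen Ω) (hc : ContDiffOn ℝ ∞ c Ω)
    (hg : ContDiffOn ℝ ∞ g Ω) (v : E) (hx : x ∈ Ω) :
    dirDeriv v (fun y => c y • g y) x = c x • dirDeriv v g x + dirDeriv v c x • g x := by
  unfold dirDeriv
  rw [fderiv_fun_smul (differentiableAt_of_contDiffOn hΩ hc hx)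
    (differentiableAt_of_contDiffOn hΩ hg hx)]
  simp

theorem dirDeriv_add (hΩ : IsOpen Ω) (hg : ContDiffOn ℝ ∞ g Ω)
    (hk : ContDiffOn ℝ ∞ k Ω) (v : E) (hx : x ∈ Ω) :
    dirDeriv v (fun y => g y + k y) x = dirDeriv v g x + dirDeriv v k x := by
  unfold dirDeriv
  rw [fderiv_fun_add (differentiableAt_of_contDiffOn hΩ hg hx)
    (differentiableAt_of_contDiffOn hΩ hk hx)]
  simp

theorem dirDeriv_const (c : G) (v x : E) : dirDeriv v (fun _ : E => c) x = 0 := by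
  simp [dirDeriv]

end

theorem dirDeriv_mul_const {c : E → ℝ} {Ω : Set E} {x : E} (hΩ : IsOpen Ω)
    (hc : ContDiffOn ℝ ∞ c Ω) (a : ℝ) (v : E) (hx : x ∈ Ω) :
    dirDeriv v (fun y => c y * a) x = dirDeriv v c x * a := by
  unfold dirDeriv
  rw [fderiv_mul_const (differentiableAt_of_contDiffOn hΩ hc hx)]
  simp [mul_comm]

theorem dirDeriv_inner [NormedAddCommGroup G] [InnerProductSpace ℝ G] {Ω : Set E} {g k : E → G}
    {x : E} (hΩ : IsOpen Ω) (hg : ContDiffOn ℝ ∞ g Ω) (hk : ContDiffOn ℝ ∞ k Ω) (v : E)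
    (hx : x ∈ Ω) :
    dirDeriv v (fun y => (inner ℝ (g y) (k y) : ℝ)) x =
      inner ℝ (g x) (dirDeriv v k x) + inner ℝ (dirDeriv v g x) (k x) :=
  fderiv_inner_apply ℝ (differentiableAt_of_contDiffOn hΩ hg hx)
    (differentiableAt_of_contDiffOn hΩ hk hx) v

end DirDeriv

/-! ### The Gauss equation in conformal coordinates -/

section Gauss

variable {E E' : Type*} [NormedAddCommGroup E] [InnerProductSpace ℝ E]
  [NormedAddCommGroup E'] [InnerProductSpace ℝ E']

/-- `F : Ω → E'` is a smooth hypersurface with conformal parametrization, `⟪dF v, dF w⟫ = φ ⟪v, w⟫`,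
and smooth unit normal field `N`. -/
structure IsConformalHypersurface (Ω : Set E) (F N : E → E') (φ : E → ℝ) : Prop where
  isOpen : IsOpen Ω
  smooth : ContDiffOn ℝ ∞ F Ω
  smooth_normal : ContDiffOn ℝ ∞ N Ω
  smooth_factor : ContDiffOn ℝ ∞ φ Ω
  pos : ∀ x ∈ Ω, 0 < φ x
  conformal : ∀ x ∈ Ω, ∀ v w : E, inner ℝ (dirDeriv v F x) (dirDeriv w F x) = φ x * inner ℝ v w
  norm_normal : ∀ x ∈ Ω, ‖N x‖ = 1
  inner_normal : ∀ x ∈ Ω, ∀ v : E, inner ℝ (N x) (dirDeriv v F x) = 0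
  eq_of_forall_inner : ∀ x ∈ Ω, ∀ X : E', (∀ v : E, inner ℝ X (dirDeriv v F x) = 0) →
    X = inner ℝ X (N x) • N x

namespace IsConformalHypersurface

variable {Ω : Set E} {F N : E → E'} {φ : E → ℝ} (H : IsConformalHypersurface Ω F N φ) {x : E}
include H

theorem ext_inner (hx : x ∈ Ω) {X Y : E'}
    (h : ∀ v : E, inner ℝ X (dirDeriv v F x) = inner ℝ Y (dirDeriv v F x))
    (hN : inner ℝ X (N x) = inner ℝ Y (N x)) : X = Y := by
  have := H.eq_of_forall_inner x hx (X - Y) fun v => by rw [inner_sub_left, h, sub_self]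
  rw [inner_sub_left, hN, sub_self, zero_smul] at this
  exact sub_eq_zero.1 this

/-- In codimension one a vector is the sum of its tangential and normal parts. The tangential part
of `Y` is `φ⁻¹ dF b`, because `dF` scales the inner product by `φ`. -/
theorem inner_eq (hx : x ∈ Ω) {X Y : E'} {a b : E}
    (hX : ∀ v : E, inner ℝ X (dirDeriv v F x) = inner ℝ a v)
    (hY : ∀ v : E, inner ℝ Y (dirDeriv v F x) = inner ℝ b v) :
    inner ℝ X Y = (φ x)⁻¹ * inner ℝ a b + inner ℝ X (N x) * inner ℝ Y (N x) := by
  have hφ := (H.pos x hx).ne'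
  have hYe : Y = (φ x)⁻¹ • dirDeriv b F x + inner ℝ Y (N x) • N x := by
    refine H.ext_inner hx (fun v => ?_) ?_
    · rw [hY, inner_add_left, real_inner_smul_left, real_inner_smul_left, H.conformal x hx,
        H.inner_normal x hx]
      field_simp; ring
    · rw [inner_add_left, real_inner_smul_left, real_inner_smul_left, real_inner_comm,
        real_inner_self_eq_norm_sq, H.norm_normal x hx, real_inner_comm (N x),
        H.inner_normal x hx]
      ring
  conv_lhs => rw [hYe]
  rw [inner_add_right, real_inner_smul_right, real_inner_smul_right, hX]
  ring

/-- The formula for the Christoffel symbols of a conformally flat metric. -/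
theorem two_mul_inner_dirDeriv_dirDeriv (hx : x ∈ Ω) (s u t : E) :
    2 * inner ℝ (dirDeriv s (dirDeriv u F) x) (dirDeriv t F x) =
      dirDeriv s φ x * inner ℝ u t + dirDeriv u φ x * inner ℝ s t
        - dirDeriv t φ x * inner ℝ s u := by
  have hS := fun v => contDiffOn_dirDeriv H.isOpen H.smooth v
  have key : ∀ a b c : E, inner ℝ (dirDeriv b F x) (dirDeriv a (dirDeriv c F) x) +
      inner ℝ (dirDeriv a (dirDeriv b F) x) (dirDeriv c F x) =
      dirDeriv a φ x * inner ℝ b c := fun a b c => by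
    rw [← dirDeriv_inner H.isOpen (hS b) (hS c) a hx,
      ← dirDeriv_mul_const H.isOpen H.smooth_factor _ _ hx]
    exact dirDeriv_congr H.isOpen (fun y hy => H.conformal y hy b c) a hx
  -- Koszul's trick: in the sum of the first two identities minus the third, all second derivatives
  -- cancel except those along `s`, `u`.
  have h1 := key s u t
  have h2 := key u s t
  have h3 := key t s u
  rw [dirDeriv_comm H.isOpen H.smooth u s hx, real_inner_comm] at h2
  rw [real_inner_comm] at h1
  rw [dirDeriv_comm H.isOpen H.smooth t s hx, dirDeriv_comm H.isOpen H.smooth t u hx,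
    real_inner_comm] at h3
  linarith

theorem inner_dirDeriv_normal (hx : x ∈ Ω) (v w : E) :
    inner ℝ (dirDeriv v N x) (dirDeriv w F x) =
      - inner ℝ (N x) (dirDeriv v (dirDeriv w F) x) := by
  have h := dirDeriv_inner H.isOpen H.smooth_normal (contDiffOn_dirDeriv H.isOpen H.smooth w) v hx
  rw [dirDeriv_congr H.isOpen (k := fun _ => (0 : ℝ)) (fun y hy => H.inner_normal y hy w) v hx,
    dirDeriv_const] at h
  linarith

theorem inner_dirDeriv_normal_comm (hx : x ∈ Ω) (v w : E) :
    inner ℝ (dirDeriv v N x) (dirDeriv w F x) = inner ℝ (dirDeriv w N x) (dirDeriv v F x) := by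
  rw [H.inner_dirDeriv_normal hx, H.inner_dirDeriv_normal hx, dirDeriv_comm H.isOpen H.smooth v w hx]

theorem inner_dirDeriv_normal_self (hx : x ∈ Ω) (v : E) :
    inner ℝ (dirDeriv v N x) (N x) = 0 := by
  have h := dirDeriv_inner H.isOpen H.smooth_normal H.smooth_normal v hx
  rw [dirDeriv_congr H.isOpen (k := fun _ => (1 : ℝ)) (fun y hy => by
    simp [H.norm_normal y hy]) v hx, dirDeriv_const,
    real_inner_comm] at h
  linarith

/-- Differentiate the Christoffel formulas for `⟪F_vv, F_w⟫ = -φ_w / 2` along `w` and `⟪F_vw, F_w⟫ =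
φ_v / 2` along `v`, then subtract. The third derivatives of `F` cancel by symmetry, so the metric
alone remains. -/
theorem inner_dirDeriv_dirDeriv_sub (hx : x ∈ Ω) {v w : E} (hv : ‖v‖ = 1) (hw : ‖w‖ = 1)
    (hvw : inner ℝ v w = 0) :
    inner ℝ (dirDeriv v (dirDeriv v F) x) (dirDeriv w (dirDeriv w F) x) -
      inner ℝ (dirDeriv v (dirDeriv w F) x) (dirDeriv v (dirDeriv w F) x) =
      - (dirDeriv v (dirDeriv v φ) x + dirDeriv w (dirDeriv w φ) x) / 2 := by
  have hS := fun v => contDiffOn_dirDeriv H.isOpen H.smooth v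
  have hSS := fun u v => contDiffOn_dirDeriv H.isOpen (hS v) u
  have hφS := fun v => contDiffOn_dirDeriv H.isOpen H.smooth_factor v
  have hvv : inner ℝ v v = (1 : ℝ) := by rw [real_inner_self_eq_norm_sq, hv]; norm_num
  have hww : inner ℝ w w = (1 : ℝ) := by rw [real_inner_self_eq_norm_sq, hw]; norm_num
  have h1 := dirDeriv_inner H.isOpen (hSS v v) (hS w) w hx
  rw [dirDeriv_congr H.isOpen (k := fun y => dirDeriv w φ y * (-1 / 2)) (fun y hy => by
    have := H.two_mul_inner_dirDeriv_dirDeriv hy v v w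
    rw [hvw, hvv] at this; simp only; linarith) w hx,
    dirDeriv_mul_const H.isOpen (hφS w) _ _ hx] at h1
  have h2 := dirDeriv_inner H.isOpen (hSS v w) (hS w) v hx
  rw [dirDeriv_congr H.isOpen (k := fun y => dirDeriv v φ y * (1 / 2)) (fun y hy => by
    have := H.two_mul_inner_dirDeriv_dirDeriv hy v w w
    rw [hvw, hww] at this; simp only; linarith) v hx,
    dirDeriv_mul_const H.isOpen (hφS v) _ _ hx] at h2
  have h3 : dirDeriv w (dirDeriv v (dirDeriv v F)) x = dirDeriv v (dirDeriv v (dirDeriv w F)) x := by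
    rw [dirDeriv_comm H.isOpen (hS v) w v hx]
    exact dirDeriv_congr H.isOpen (fun y hy => dirDeriv_comm H.isOpen H.smooth w v hy) v hx
  rw [h3] at h1
  linarith

/-- The sectional curvature `h v v * h w w - h v w ^ 2` of a conformally flat hypersurface is a sum
of terms depending on `v` and on `w` only. -/
theorem exists_gauss [FiniteDimensional ℝ E] (hx : x ∈ Ω) : ∃ a : E → ℝ, ∀ v w : E, ‖v‖ = 1 → ‖w‖ = 1 →
    inner ℝ v w = 0 →
    inner ℝ (dirDeriv v N x) (dirDeriv v F x) * inner ℝ (dirDeriv w N x) (dirDeriv w F x) -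
      inner ℝ (dirDeriv v N x) (dirDeriv w F x) ^ 2 = a v + a w := by
  have : CompleteSpace E := FiniteDimensional.complete ℝ E
  obtain ⟨G, hG⟩ : ∃ G : E, ∀ v, inner ℝ G v = dirDeriv v φ x :=
    ⟨(InnerProductSpace.toDual ℝ E).symm (fderiv ℝ φ x), fun v => by
      rw [InnerProductSpace.toDual_symm_apply]; rfl⟩
  -- The tangential parts of the second derivatives contribute `φ⁻¹ (|G|² / 4 - 3/4 (φ_v² + φ_w²))`,
  -- where `G` is the Euclidean gradient of `φ`. The symmetric constant `|G|² / 4` is shared equally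
  -- between `v` and `w`.
  refine ⟨fun v => - dirDeriv v (dirDeriv v φ) x / 2 -
    (φ x)⁻¹ * (inner ℝ G G / 8 - 3 / 4 * dirDeriv v φ x ^ 2), fun v w hv hw hvw => ?_⟩
  have hvv : inner ℝ v v = (1 : ℝ) := by rw [real_inner_self_eq_norm_sq, hv]; norm_num
  have hww : inner ℝ w w = (1 : ℝ) := by rw [real_inner_self_eq_norm_sq, hw]; norm_num
  have hwv : inner ℝ w v = (0 : ℝ) := by rw [real_inner_comm, hvw]
  have tang : ∀ s u t : E, inner ℝ (dirDeriv s (dirDeriv u F) x) (dirDeriv t F x) =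
      inner ℝ ((dirDeriv s φ x / 2) • u + (dirDeriv u φ x / 2) • s - (inner ℝ s u / 2 : ℝ) • G) t :=
    fun s u t => by
      have := H.two_mul_inner_dirDeriv_dirDeriv hx s u t
      rw [inner_sub_left, inner_add_left, real_inner_smul_left, real_inner_smul_left,
        real_inner_smul_left, hG]
      linarith
  have hGv := hG v
  have hGw := hG w
  have hvG : inner ℝ v G = dirDeriv v φ x := by rw [real_inner_comm, hG]
  have hwG : inner ℝ w G = dirDeriv w φ x := by rw [real_inner_comm, hG]
  have h0 := H.inner_dirDeriv_dirDeriv_sub hx hv hw hvw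
  rw [H.inner_eq hx (tang v v) (tang w w), H.inner_eq hx (tang v w) (tang v w)] at h0
  simp only [inner_sub_left, inner_add_left, real_inner_smul_left, inner_sub_right,
    inner_add_right, real_inner_smul_right, hvw, hwv, hvv, hww, hGv, hGw, hvG, hwG] at h0
  rw [H.inner_dirDeriv_normal hx, H.inner_dirDeriv_normal hx, H.inner_dirDeriv_normal hx,
    real_inner_comm, real_inner_comm (dirDeriv w (dirDeriv w F) x),
    real_inner_comm (dirDeriv v (dirDeriv w F) x)]
  linear_combination h0

end IsConformalHypersurface

end Gauss

/-! ### Recovering a rank-one coefficient from traces -/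

section Trace

variable {ι : Type*} [Fintype ι] [DecidableEq ι]

/-- The traceless part of a square matrix. -/
def tracelessPart (m : Matrix ι ι ℝ) : Matrix ι ι ℝ :=
  m - (m.trace / Fintype.card ι) • (1 : Matrix ι ι ℝ)

/-- A rational expression in the entries of a matrix that recovers `d` from
`l • 1 + d • u ⊗ u`, `|u| = 1`. -/
def rankOneCoeff (m : Matrix ι ι ℝ) : ℝ :=
  (tracelessPart m * tracelessPart m * tracelessPart m).trace /
    ((tracelessPart m * tracelessPart m).trace * (1 - 2 / Fintype.card ι))

variable {u : ι → ℝ} (hu : u ⬝ᵥ u = 1) (hι : 3 ≤ Fintype.card ι) (l d : ℝ)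
include hu

theorem trace_smul_one_add_rankOne :
    (l • (1 : Matrix ι ι ℝ) + d • Matrix.vecMulVec u u).trace = Fintype.card ι * l + d := by
  simp [Matrix.trace_add, Matrix.trace_smul, hu, mul_comm]

include hι

/-- With `P = u ⊗ u` a projection of trace one, the traceless part is `d (P - 1/n)`. The trace of
its square determines only `d ^ 2`; that of its cube is `d ^ 3 (1 - 1/n) (1 - 2/n)`, and the
quotient recovers `d` with its sign. This makes the coefficient smooth in the matrix entries
wherever `d ≠ 0`. -/
theorem traces_tracelessPart {m : Matrix ι ι ℝ}
    (hm : m = l • (1 : Matrix ι ι ℝ) + d • Matrix.vecMulVec u u) :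
    (tracelessPart m * tracelessPart m).trace = d ^ 2 * (1 - 1 / Fintype.card ι) ∧
    rankOneCoeff m = d := by
  set n : ℝ := (Fintype.card ι : ℝ) with hn
  have hn3 : (3 : ℝ) ≤ n := by rw [hn]; exact_mod_cast hι
  have hn0 : n ≠ 0 := by linarith
  set P := Matrix.vecMulVec u u with hP
  have hPP : P * P = P := by
    rw [hP, Matrix.vecMulVec_mul_vecMulVec, hu, one_smul]
  have htP : P.trace = 1 := by rw [hP, Matrix.trace_vecMulVec, hu]
  have ht1 : (1 : Matrix ι ι ℝ).trace = n := by simp [hn]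
  have h0 : tracelessPart m = d • P - (d / n) • (1 : Matrix ι ι ℝ) := by
    unfold tracelessPart
    have : m.trace = n * l + d := by rw [hm]; exact trace_smul_one_add_rankOne hu l d
    rw [this, hm, show (n * l + d) / n = l + d / n by field_simp, add_smul]
    abel
  have h2 : tracelessPart m * tracelessPart m =
      (d ^ 2 * (1 - 2 / n)) • P + (d / n) ^ 2 • (1 : Matrix ι ι ℝ) := by
    rw [h0]
    simp only [sub_mul, mul_sub, smul_mul_assoc, mul_smul_comm, one_mul, mul_one, hPP]
    module
  have h3 : tracelessPart m * tracelessPart m * tracelessPart m =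
      (d ^ 3 * (1 - 2 / n) * (1 - 1 / n) + d ^ 3 / n ^ 2) • P
        - (d / n) ^ 3 • (1 : Matrix ι ι ℝ) := by
    rw [h2, h0]
    simp only [add_mul, mul_sub, smul_mul_assoc, mul_smul_comm, one_mul, mul_one, hPP]
    module
  have t2 : (tracelessPart m * tracelessPart m).trace = d ^ 2 * (1 - 1 / n) := by
    rw [h2, Matrix.trace_add, Matrix.trace_smul, Matrix.trace_smul, htP, ht1]
    simp only [smul_eq_mul]; field_simp; ring
  have t3 : (tracelessPart m * tracelessPart m * tracelessPart m).trace =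
      d ^ 3 * (1 - 1 / n) * (1 - 2 / n) := by
    rw [h3, Matrix.trace_sub, Matrix.trace_smul, Matrix.trace_smul, htP, ht1]
    simp only [smul_eq_mul]; field_simp; ring
  refine ⟨t2, ?_⟩
  rw [rankOneCoeff, t2, t3, ← hn]
  have a1 : (1 - 1 / n) ≠ 0 := by
    have : n - 1 ≠ 0 := by linarith
    rw [one_sub_div hn0]; exact div_ne_zero this hn0
  have a2 : (1 - 2 / n) ≠ 0 := by
    have : n - 2 ≠ 0 := by linarith
    rw [one_sub_div hn0]; exact div_ne_zero this hn0
  -- For `d = 0` the quotient is `0 / 0`, whose value `0` is the right one.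
  by_cases hd : d = 0
  · simp [hd]
  · rw [mul_assoc, div_eq_iff (mul_ne_zero (mul_ne_zero (pow_ne_zero 2 hd) a1) a2)]
    ring

end Trace

/-! ### Principal curvatures and their smoothness -/

section Principal

variable {E E' : Type*} [NormedAddCommGroup E] [InnerProductSpace ℝ E] [FiniteDimensional ℝ E]
  [NormedAddCommGroup E'] [InnerProductSpace ℝ E'] [CompleteSpace E']

namespace IsConformalHypersurface

variable {Ω : Set E} {F N : E → E'} {φ : E → ℝ} (H : IsConformalHypersurface Ω F N φ) {x : E}
include H

/-- Cartan: a conformally flat hypersurface of dimension at least four has a principal curvature of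
multiplicity at least `n - 1`. -/
theorem exists_rankOne_secondFundamentalForm (hdim : 4 ≤ Module.finrank ℝ E) (hx : x ∈ Ω) :
    ∃ (η : E) (l d : ℝ), ‖η‖ = 1 ∧ ∀ v w : E,
      - inner ℝ (dirDeriv v N x) (dirDeriv w F x) =
        l * inner ℝ v w + d * (inner ℝ η v * inner ℝ η w) := by
  have : CompleteSpace E := FiniteDimensional.complete ℝ E
  set T : E →L[ℝ] E := - (ContinuousLinearMap.adjoint (fderiv ℝ F x)).comp (fderiv ℝ N x) with hTdef
  have hT : ∀ v w, inner ℝ (T v) w = - inner ℝ (dirDeriv v N x) (dirDeriv w F x) := fun v w => by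
    simp [hTdef, dirDeriv, ContinuousLinearMap.adjoint_inner_left]
  obtain ⟨a, ha⟩ := H.exists_gauss hx
  obtain ⟨η, l, d, hη, h⟩ := exists_eq_smul_add_rankOne (T := T) (fun v w => by
    change inner ℝ (T v) w = inner ℝ v (T w)
    rw [hT, real_inner_comm (T w) v, hT, H.inner_dirDeriv_normal_comm hx]) hdim a
    fun v w hv hw hvw => by
      rw [hT, hT, hT, ← ha v w hv hw hvw]; ring
  refine ⟨η, l, d, hη, fun v w => ?_⟩
  rw [← hT, h, inner_add_left, real_inner_smul_left, real_inner_smul_left]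
  ring

-- The Weingarten equation. The coefficients `l`, `d` are taken relative to the Euclidean inner
-- product of the chart; dividing by `φ` makes them relative to the induced metric.
omit [FiniteDimensional ℝ E] [CompleteSpace E'] in
theorem dirDeriv_normal_eq (hx : x ∈ Ω) {η : E} {l d : ℝ} (h : ∀ v w : E,
      - inner ℝ (dirDeriv v N x) (dirDeriv w F x) =
        l * inner ℝ v w + d * (inner ℝ η v * inner ℝ η w)) (v : E) :
    dirDeriv v N x =
      - ((l / φ x) • dirDeriv v F x + (d / φ x * inner ℝ η v) • dirDeriv η F x) := by
  have hφ := (H.pos x hx).ne'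
  refine H.ext_inner hx (fun w => ?_) ?_
  · rw [inner_neg_left, inner_add_left, real_inner_smul_left, real_inner_smul_left,
      H.conformal x hx, H.conformal x hx]
    have := h v w
    field_simp
    linarith
  · rw [H.inner_dirDeriv_normal_self hx, inner_neg_left, inner_add_left, real_inner_smul_left,
      real_inner_smul_left, real_inner_comm (N x), H.inner_normal x hx, real_inner_comm (N x),
      H.inner_normal x hx]
    ring

/-- Near every point, the principal curvatures and the principal direction of multiplicity one of a
conformally flat hypersurface without umbilical points are smooth. -/
theorem exists_smooth_principal (hdim : 4 ≤ Module.finrank ℝ E)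
    (humb : ∀ x ∈ Ω, ¬ ∃ c : ℝ, ∀ v w : E,
      - inner ℝ (dirDeriv v N x) (dirDeriv w F x) = c * inner ℝ v w) (hx : x ∈ Ω) :
    ∃ (W : Set E) (κ δ : E → ℝ) (η : E → E), IsOpen W ∧ x ∈ W ∧ W ⊆ Ω ∧
      ContDiffOn ℝ ∞ κ W ∧ ContDiffOn ℝ ∞ δ W ∧ ContDiffOn ℝ ∞ η W ∧
      ∀ y ∈ W, ‖η y‖ = 1 ∧ δ y ≠ 0 ∧ ∀ v : E, dirDeriv v N y =
        - (κ y • dirDeriv v F y + (δ y * inner ℝ (η y) v) • dirDeriv (η y) F y) := by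
  classical
  set e := stdOrthonormalBasis ℝ E with he
  set ι := Fin (Module.finrank ℝ E) with hιdef
  have hcard : 3 ≤ Fintype.card ι := by simp [ι]; omega
  set n : ℝ := (Fintype.card ι : ℝ) with hn
  have hn0 : n ≠ 0 := by
    rw [hn]; exact_mod_cast (show Fintype.card ι ≠ 0 by omega)
  set h : E → E → E → ℝ := fun v w y => - inner ℝ (dirDeriv v N y) (dirDeriv w F y) with hh
  have hsm : ∀ v w, ContDiffOn ℝ ∞ (h v w) Ω := fun v w =>
    ((contDiffOn_dirDeriv H.isOpen H.smooth_normal v).inner ℝ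
      (contDiffOn_dirDeriv H.isOpen H.smooth w)).neg
  set m : E → Matrix ι ι ℝ := fun y => Matrix.of fun i j => h (e i) (e j) y with hm
  set d : E → ℝ := fun y => rankOneCoeff (m y) with hd
  set l : E → ℝ := fun y => ((m y).trace - d y) / n with hl
  -- the pointwise normal form, with coefficients given by `l` and `d`
  have hpt : ∀ y ∈ Ω, ∃ η : E, ‖η‖ = 1 ∧ d y ≠ 0 ∧
      (tracelessPart (m y) * tracelessPart (m y)).trace ≠ 0 ∧ ∀ v w : E,
      h v w y = l y * inner ℝ v w + d y * (inner ℝ η v * inner ℝ η w) := by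
    intro y hy
    obtain ⟨η, l', d', hη, hld⟩ := H.exists_rankOne_secondFundamentalForm hdim hy
    set u : ι → ℝ := fun i => inner ℝ η (e i) with hu
    have huu : u ⬝ᵥ u = 1 := by
      have := e.sum_sq_norm_inner_left η
      rw [hη] at this
      simp only [dotProduct, hu]
      simpa [sq] using this
    have hmy : m y = l' • (1 : Matrix ι ι ℝ) + d' • Matrix.vecMulVec u u := by
      ext i j
      have hij : inner ℝ (e i) (e j) = if i = j then (1 : ℝ) else 0 :=
        orthonormal_iff_ite.1 e.orthonormal i j
      simp [hm, hh, hld, Matrix.one_apply, Matrix.vecMulVec_apply, hu, hij]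
    have hd' : d y = d' := (traces_tracelessPart huu hcard l' d' hmy).2
    have hl' : l y = l' := by
      simp only [hl, hd', hmy]
      rw [trace_smul_one_add_rankOne huu l' d', ← hn]
      field_simp; ring
    have hne : d' ≠ 0 := fun h0 => humb y hy ⟨l', fun v w => by rw [hld v w, h0]; ring⟩
    refine ⟨η, hη, by rw [hd']; exact hne, ?_, fun v w => by rw [hd', hl']; exact hld v w⟩
    rw [(traces_tracelessPart huu hcard l' d' hmy).1, ← hn]
    have : n - 1 ≠ 0 := by
      have : (3 : ℝ) ≤ n := by rw [hn]; exact_mod_cast hcard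
      linarith
    refine mul_ne_zero (pow_ne_zero _ hne) ?_
    rw [one_sub_div hn0]; exact div_ne_zero this hn0
  -- smoothness of the coefficients
  have hmsm : ∀ i j, ContDiffOn ℝ ∞ (fun y => m y i j) Ω := fun i j => hsm _ _
  have htr : ContDiffOn ℝ ∞ (fun y => (m y).trace) Ω := by
    simp only [Matrix.trace, Matrix.diag]
    exact ContDiffOn.sum fun i _ => hmsm i i
  have htl : ∀ i j, ContDiffOn ℝ ∞ (fun y => tracelessPart (m y) i j) Ω := fun i j => by
    simp only [tracelessPart, Matrix.sub_apply, Matrix.smul_apply, smul_eq_mul]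
    exact (hmsm i j).sub ((htr.div_const _).mul contDiffOn_const)
  have htl2 : ∀ i j, ContDiffOn ℝ ∞ (fun y => (tracelessPart (m y) * tracelessPart (m y)) i j) Ω :=
    fun i j => by
      simp only [Matrix.mul_apply]
      exact ContDiffOn.sum fun k _ => (htl i k).mul (htl k j)
  have hdsm : ContDiffOn ℝ ∞ d Ω := by
    have h3 : ContDiffOn ℝ ∞ (fun y =>
        (tracelessPart (m y) * tracelessPart (m y) * tracelessPart (m y)).trace) Ω := by
      simp only [Matrix.trace, Matrix.diag]
      refine ContDiffOn.sum fun i _ => ?_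
      simp only [fun y => Matrix.mul_apply (M := tracelessPart (m y) * tracelessPart (m y))
        (N := tracelessPart (m y)) (i := i) (k := i)]
      exact ContDiffOn.sum fun k _ => (htl2 i k).mul (htl k i)
    have h2 : ContDiffOn ℝ ∞ (fun y => (tracelessPart (m y) * tracelessPart (m y)).trace) Ω := by
      simp only [Matrix.trace, Matrix.diag]
      exact ContDiffOn.sum fun i _ => htl2 i i
    refine h3.div (h2.mul contDiffOn_const) fun y hy => ?_
    obtain ⟨η, -, -, h0, -⟩ := hpt y hy
    refine mul_ne_zero h0 ?_
    have : (3 : ℝ) ≤ Fintype.card ι := by exact_mod_cast hcard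
    have h2 : (Fintype.card ι : ℝ) - 2 ≠ 0 := by linarith
    have h3 : (Fintype.card ι : ℝ) ≠ 0 := by linarith
    rw [one_sub_div h3]; exact div_ne_zero h2 h3
  have hlsm : ContDiffOn ℝ ∞ l Ω := (htr.sub hdsm).div_const _
  obtain ⟨η₀, hη₀, -, -, hx₀⟩ := hpt x hx
  -- The unit vector in the rank-one term is determined only up to sign, so a pointwise choice need
  -- not be continuous. The projection onto its line is smooth: `Q v` is the inner product of `v`
  -- with the projection of the fixed vector `η₀`.
  set Q : E → E → ℝ := fun v y => (h η₀ v y - l y * inner ℝ η₀ v) / d y with hQ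
  have hQsm : ∀ v, ContDiffOn ℝ ∞ (Q v) Ω := fun v =>
    ((hsm η₀ v).sub (hlsm.mul contDiffOn_const)).div hdsm fun y hy => (hpt y hy).choose_spec.2.1
  have hQx : Q η₀ x = 1 := by
    have hd0 : d x ≠ 0 := (hpt x hx).choose_spec.2.1
    simp only [hQ, hx₀, real_inner_self_eq_norm_sq, hη₀]
    field_simp; ring
  set W : Set E := Ω ∩ Q η₀ ⁻¹' Ioi 0 with hW
  have hWo : IsOpen W := (hQsm η₀).continuousOn.isOpen_inter_preimage H.isOpen isOpen_Ioi
  have hWΩ : W ⊆ Ω := inter_subset_left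
  -- The sum is the projection of `η₀` and `Q η₀ y` is its squared length, positive on `W`. The
  -- normalized vector is the one of the two unit vectors that has positive inner product with `η₀`.
  set η : E → E := fun y => (Real.sqrt (Q η₀ y))⁻¹ • ∑ i, Q (e i) y • e i with hηdef
  have hφ : ∀ y ∈ W, φ y ≠ 0 := fun y hy => (H.pos y (hWΩ hy)).ne'
  refine ⟨W, fun y => l y / φ y, fun y => d y / φ y, η, hWo, ⟨hx, by simp [hQx]⟩, hWΩ,
    (hlsm.mono hWΩ).div (H.smooth_factor.mono hWΩ) hφ,
    (hdsm.mono hWΩ).div (H.smooth_factor.mono hWΩ) hφ, ?_, fun y hy => ?_⟩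
  · refine ContDiffOn.smul (ContDiffOn.inv (((hQsm η₀).mono hWΩ).sqrt fun y hy => ?_) fun y hy => ?_)
      (ContDiffOn.sum fun i _ => ((hQsm (e i)).mono hWΩ).smul contDiffOn_const)
    · exact (show 0 < Q η₀ y from hy.2).ne'
    · exact (Real.sqrt_pos.2 hy.2).ne'
  · obtain ⟨ζ, hζ, hd0, -, hz⟩ := hpt y (hWΩ hy)
    have hQy : ∀ v, Q v y = inner ℝ ζ η₀ * inner ℝ ζ v := fun v => by
      simp only [hQ, hz]; field_simp; ring
    set s : ℝ := (Real.sqrt (Q η₀ y))⁻¹ * inner ℝ ζ η₀ with hs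
    have hηy : η y = s • ζ := by
      have : ∑ i, Q (e i) y • e i = (inner ℝ ζ η₀ : ℝ) • ζ := by
        have hζs := congrArg ((inner ℝ ζ η₀ : ℝ) • ·) (e.sum_repr' ζ)
        simp only [Finset.smul_sum] at hζs
        rw [← hζs]
        refine Finset.sum_congr rfl fun i _ => ?_
        rw [hQy, mul_smul, real_inner_comm ζ]
      simp only [hηdef]
      rw [this, hs, mul_smul]
    have hpos : 0 < Q η₀ y := hy.2
    have hs2 : s ^ 2 = 1 := by
      rw [hs, mul_pow, inv_pow, Real.sq_sqrt hpos.le]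
      rw [hQy] at hpos ⊢
      rw [← sq] at hpos ⊢
      exact inv_mul_cancel₀ hpos.ne'
    refine ⟨?_, div_ne_zero hd0 (hφ y hy), fun v => ?_⟩
    · rw [hηy, norm_smul, hζ, mul_one, Real.norm_eq_abs, ← pow_eq_one_iff_of_nonneg (abs_nonneg _)
        two_ne_zero, sq_abs, hs2]
    · refine H.dirDeriv_normal_eq (hWΩ hy) (fun v w => ?_) v
      have := hz v w
      simp only [hh] at this
      rw [this, hηy, real_inner_smul_left, real_inner_smul_left]
      linear_combination (-(d y) * inner ℝ ζ v * inner ℝ ζ w) * hs2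

end IsConformalHypersurface

end Principal

/-! ### Codazzi equations and constancy along the leaves -/

section StructureEquations

/-- Supplies a second leaf direction orthogonal to a given one, against which the Codazzi-type
identities are tested. -/
theorem exists_unit_orthogonal_pair {E : Type*} [NormedAddCommGroup E] [InnerProductSpace ℝ E]
    [FiniteDimensional ℝ E] (hdim : 3 ≤ Module.finrank ℝ E) (u w : E) :
    ∃ v : E, ‖v‖ = 1 ∧ inner ℝ u v = 0 ∧ inner ℝ w v = 0 := by
  classical
  set K := Submodule.span ℝ (({u, w} : Finset E) : Set E) with hK
  have h1 : Module.finrank ℝ K ≤ 2 :=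
    (finrank_span_finset_le_card _).trans Finset.card_le_two
  have h2 := K.finrank_add_finrank_orthogonal
  have h3 : Kᗮ ≠ ⊥ := fun h => by
    rw [h, finrank_bot] at h2; omega
  obtain ⟨v, hv, hv0⟩ := Kᗮ.ne_bot_iff.1 h3
  have hin : ∀ a ∈ K, inner ℝ a v = 0 := fun a ha => Submodule.inner_right_of_mem_orthogonal ha hv
  refine ⟨(‖v‖)⁻¹ • v, norm_smul_inv_norm hv0, ?_, ?_⟩
  · rw [real_inner_smul_right, hin u (Submodule.subset_span (by simp)), mul_zero]
  · rw [real_inner_smul_right, hin w (Submodule.subset_span (by simp)), mul_zero]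

variable {E E' : Type*} [NormedAddCommGroup E] [InnerProductSpace ℝ E]

/-- The chain rule, used to show that functions of `κ` and `ρ` are constant along the leaves. -/
theorem dirDeriv_comp_pair_eq_zero {a b : E → ℝ} {g : ℝ × ℝ → ℝ} {x w : E}
    (ha : DifferentiableAt ℝ a x) (hb : DifferentiableAt ℝ b x)
    (hg : DifferentiableAt ℝ g (a x, b x)) (ha0 : dirDeriv w a x = 0)
    (hb0 : dirDeriv w b x = 0) : dirDeriv w (fun y => g (a y, b y)) x = 0 := by
  have h := hg.hasFDerivAt.comp x (ha.hasFDerivAt.prodMk hb.hasFDerivAt)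
  have h' : fderiv ℝ (fun y => g (a y, b y)) x = _ := h.fderiv
  unfold dirDeriv at *
  rw [h']
  simp only [ContinuousLinearMap.comp_apply, ContinuousLinearMap.prod_apply, ha0, hb0]
  exact map_zero _

theorem dirDeriv_add_left [NormedAddCommGroup E'] [NormedSpace ℝ E'] (v w : E) (g : E → E')
    (x : E) : dirDeriv (v + w) g x = dirDeriv v g x + dirDeriv w g x := by
  simp [dirDeriv]

theorem dirDeriv_smul_left [NormedAddCommGroup E'] [NormedSpace ℝ E'] (t : ℝ) (v : E)
    (g : E → E') (x : E) : dirDeriv (t • v) g x = t • dirDeriv v g x := by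
  simp [dirDeriv]

variable [NormedAddCommGroup E'] [InnerProductSpace ℝ E']

/-- The symmetry of second derivatives of `X`, where `dX = ρ dF + ⟪η, ·⟫ Y`. -/
theorem dirDeriv_antisymm {Ω : Set E} {F X Y : E → E'} {ρ : E → ℝ} {η : E → E} {x : E}
    (hΩ : IsOpen Ω) (hF : ContDiffOn ℝ ∞ F Ω) (hX : ContDiffOn ℝ ∞ X Ω)
    (hY : ContDiffOn ℝ ∞ Y Ω) (hρ : ContDiffOn ℝ ∞ ρ Ω) (hη : ContDiffOn ℝ ∞ η Ω)
    (h : ∀ y ∈ Ω, ∀ v : E, dirDeriv v X y = ρ y • dirDeriv v F y + (inner ℝ (η y) v : ℝ) • Y y)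
    (hx : x ∈ Ω) (v w : E) :
    dirDeriv w ρ x • dirDeriv v F x + (inner ℝ (dirDeriv w η x) v : ℝ) • Y x +
        (inner ℝ (η x) v : ℝ) • dirDeriv w Y x =
      dirDeriv v ρ x • dirDeriv w F x + (inner ℝ (dirDeriv v η x) w : ℝ) • Y x +
        (inner ℝ (η x) w : ℝ) • dirDeriv v Y x := by
  have key : ∀ v w : E, dirDeriv w (dirDeriv v X) x =
      ρ x • dirDeriv w (dirDeriv v F) x + dirDeriv w ρ x • dirDeriv v F x +
      ((inner ℝ (η x) v : ℝ) • dirDeriv w Y x + (inner ℝ (dirDeriv w η x) v : ℝ) • Y x) := by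
    intro v w
    have hFv := contDiffOn_dirDeriv hΩ hF v
    have hi : ContDiffOn ℝ ∞ (fun y => (inner ℝ (η y) v : ℝ)) Ω := hη.inner ℝ contDiffOn_const
    have hid : dirDeriv w (fun y => (inner ℝ (η y) v : ℝ)) x = inner ℝ (dirDeriv w η x) v := by
      rw [dirDeriv_inner hΩ hη contDiffOn_const w hx, dirDeriv_const, inner_zero_right, zero_add]
    rw [dirDeriv_congr hΩ (fun y hy => h y hy v) w hx,
      dirDeriv_add (g := fun y => ρ y • dirDeriv v F y) (k := fun y => (inner ℝ (η y) v : ℝ) • Y y)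
        hΩ (hρ.smul hFv) (hi.smul hY) w hx, dirDeriv_smul hΩ hρ hFv w hx,
      dirDeriv_smul hΩ hi hY w hx, hid]
  have hc := dirDeriv_comm hΩ hX w v hx
  rw [key v w, key w v, dirDeriv_comm hΩ hF w v hx] at hc
  rw [← sub_eq_zero] at hc ⊢
  rw [← hc]
  abel

namespace IsConformalHypersurface

variable {Ω : Set E} {F N : E → E'} {φ : E → ℝ}

theorem mono (H : IsConformalHypersurface Ω F N φ) {W : Set E} (hW : IsOpen W) (h : W ⊆ Ω) :
    IsConformalHypersurface W F N φ where
  isOpen := hW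
  smooth := H.smooth.mono h
  smooth_normal := H.smooth_normal.mono h
  smooth_factor := H.smooth_factor.mono h
  pos x hx := H.pos x (h hx)
  conformal x hx := H.conformal x (h hx)
  norm_normal x hx := H.norm_normal x (h hx)
  inner_normal x hx := H.inner_normal x (h hx)
  eq_of_forall_inner x hx := H.eq_of_forall_inner x (h hx)

end IsConformalHypersurface

/-- `κ` and `κ + δ` are the principal curvatures of a conformally parametrized hypersurface `F`,
with `η` spanning the principal direction of `κ + δ`. -/
structure IsPrincipal (Ω : Set E) (F N : E → E') (φ κ δ : E → ℝ) (η : E → E) : Prop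
    extends IsConformalHypersurface Ω F N φ where
  smooth_κ : ContDiffOn ℝ ∞ κ Ω
  smooth_δ : ContDiffOn ℝ ∞ δ Ω
  smooth_η : ContDiffOn ℝ ∞ η Ω
  norm_η : ∀ x ∈ Ω, ‖η x‖ = 1
  δ_ne_zero : ∀ x ∈ Ω, δ x ≠ 0
  dirDeriv_normal : ∀ x ∈ Ω, ∀ v : E, dirDeriv v N x =
    - (κ x • dirDeriv v F x + (δ x * inner ℝ (η x) v) • dirDeriv (η x) F x)

namespace IsPrincipal

variable {Ω : Set E} {F N : E → E'} {φ κ δ : E → ℝ} {η : E → E}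
  (H : IsPrincipal Ω F N φ κ δ η) {x : E}
include H

theorem smooth_along {G : Type*} [NormedAddCommGroup G] [NormedSpace ℝ G] {g : E → G}
    (hg : ContDiffOn ℝ ∞ g Ω) : ContDiffOn ℝ ∞ (fun y => dirDeriv (η y) g y) Ω :=
  (hg.fderiv_of_isOpen H.isOpen (m := ∞) (by simp)).clm_apply H.smooth_η

theorem inner_η_self (hx : x ∈ Ω) : inner ℝ (η x) (η x) = (1 : ℝ) := by
  rw [real_inner_self_eq_norm_sq, H.norm_η x hx]; norm_num

theorem inner_dirDeriv_η (hx : x ∈ Ω) (w : E) : inner ℝ (dirDeriv w η x) (η x) = (0 : ℝ) := by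
  have h := dirDeriv_inner H.isOpen H.smooth_η H.smooth_η w hx
  rw [dirDeriv_congr H.isOpen (k := fun _ => (1 : ℝ)) (fun y hy => H.inner_η_self hy) w hx,
    dirDeriv_const, real_inner_comm] at h
  linarith

/-- The Codazzi equation, as the symmetry of the second derivatives of `-N`, in ambient vector form.
Its components along `dF v` and `dF η` give the structure equations below. -/
theorem antisymm_normal (hx : x ∈ Ω) (v w : E) :
    dirDeriv w κ x • dirDeriv v F x +
        (inner ℝ (dirDeriv w η x) v : ℝ) • (δ x • dirDeriv (η x) F x) +
        (inner ℝ (η x) v : ℝ) • dirDeriv w (fun y => δ y • dirDeriv (η y) F y) x =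
      dirDeriv v κ x • dirDeriv w F x +
        (inner ℝ (dirDeriv v η x) w : ℝ) • (δ x • dirDeriv (η x) F x) +
        (inner ℝ (η x) w : ℝ) • dirDeriv v (fun y => δ y • dirDeriv (η y) F y) x := by
  refine dirDeriv_antisymm (X := fun y => - N y)
    (Y := fun y => δ y • dirDeriv (η y) F y) H.isOpen H.smooth H.smooth_normal.neg
    (H.smooth_δ.smul (H.smooth_along H.smooth)) H.smooth_κ H.smooth_η (fun y hy v => ?_) hx v w
  have : dirDeriv v (fun y => - N y) y = - dirDeriv v N y := by simp [dirDeriv]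
  rw [this, H.dirDeriv_normal y hy, neg_neg, smul_smul, mul_comm (inner ℝ (η y) v)]

variable [FiniteDimensional ℝ E] (hdim : 3 ≤ Module.finrank ℝ E)
include hdim

/-- The principal curvature of multiplicity `n - 1` is constant along its curvature leaves. -/
theorem dirDeriv_κ (hx : x ∈ Ω) {w : E} (hw : inner ℝ (η x) w = 0) : dirDeriv w κ x = 0 := by
  obtain ⟨v, hv, hηv, hwv⟩ := exists_unit_orthogonal_pair hdim (η x) w
  have h := congrArg (fun X => inner ℝ X (dirDeriv v F x)) (H.antisymm_normal hx v w)
  simp only [hηv, hw, zero_smul, add_zero, inner_add_left, real_inner_smul_left,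
    H.conformal x hx, hwv, real_inner_self_eq_norm_sq, hv] at h
  have hφ := (H.pos x hx).ne'
  simpa [hφ] using h

/-- The curvature distribution `η^⊥` is integrable. -/
theorem inner_dirDeriv_η_comm (hx : x ∈ Ω) {v w : E} (hv : inner ℝ (η x) v = 0)
    (hw : inner ℝ (η x) w = 0) :
    inner ℝ (dirDeriv w η x) v = (inner ℝ (dirDeriv v η x) w : ℝ) := by
  have h := congrArg (fun X => inner ℝ X (dirDeriv (η x) F x)) (H.antisymm_normal hx v w)
  simp only [hv, hw, H.dirDeriv_κ hdim hx hv, H.dirDeriv_κ hdim hx hw, zero_smul, add_zero,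
    zero_add, real_inner_smul_left, H.conformal x hx, H.inner_η_self hx] at h
  have hφ := (H.pos x hx).ne'
  have hδ := H.δ_ne_zero x hx
  exact mul_right_cancel₀ (mul_ne_zero hδ (mul_ne_zero hφ one_ne_zero)) h

/-- The unit tangent vector field of the hypersurface in the direction `dF η` has derivative
proportional to `dF` along the curvature leaves. -/
theorem dirDeriv_unitDirection (hx : x ∈ Ω) {w : E} (hw : inner ℝ (η x) w = 0) :
    dirDeriv w (fun y => (Real.sqrt (φ y))⁻¹ • dirDeriv (η y) F y) x =
      ((Real.sqrt (φ x))⁻¹ * (dirDeriv (η x) κ x / δ x)) • dirDeriv w F x := by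
  have hδ := H.δ_ne_zero x hx
  have hφ := H.pos x hx
  have hZ := H.smooth_along H.smooth
  have hs : ContDiffOn ℝ ∞ (fun y => (Real.sqrt (φ y))⁻¹) Ω :=
    (H.smooth_factor.sqrt fun y hy => (H.pos y hy).ne').inv
      fun y hy => (Real.sqrt_pos.2 (H.pos y hy)).ne'
  set ξ := fun y => (Real.sqrt (φ y))⁻¹ • dirDeriv (η y) F y with hξ
  have h := H.antisymm_normal hx (η x) w
  rw [dirDeriv_smul H.isOpen H.smooth_δ hZ w hx, H.dirDeriv_κ hdim hx hw, H.inner_dirDeriv_η hx,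
    H.inner_η_self hx, hw, zero_smul, zero_smul, zero_smul, zero_add, zero_add, one_smul,
    add_zero] at h
  -- Codazzi for the pair `η`, `w` gives the derivative modulo `dF η`. The remaining coefficient `τ`
  -- vanishes because `ξ` has unit length and `dF w` is orthogonal to `dF η`.
  obtain ⟨τ, hτ⟩ : ∃ τ : ℝ, dirDeriv w ξ x =
      ((Real.sqrt (φ x))⁻¹ * (dirDeriv (η x) κ x / δ x)) • dirDeriv w F x +
        τ • dirDeriv (η x) F x := by
    have h1 : dirDeriv w (fun y => dirDeriv (η y) F y) x =
        (dirDeriv (η x) κ x / δ x) • dirDeriv w F x +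
        (inner ℝ (dirDeriv (η x) η x) w - dirDeriv w δ x / δ x) • dirDeriv (η x) F x := by
      have h2 := congrArg ((δ x)⁻¹ • ·) (eq_sub_of_add_eq h)
      simp only [smul_smul, inv_mul_cancel₀ hδ, one_smul, smul_sub, smul_add] at h2
      rw [h2]
      rw [div_eq_inv_mul, div_eq_inv_mul, sub_smul,
        show (δ x)⁻¹ * (inner ℝ (dirDeriv (η x) η x) w * δ x) = inner ℝ (dirDeriv (η x) η x) w by
          field_simp]
      abel
    refine ⟨(Real.sqrt (φ x))⁻¹ * (inner ℝ (dirDeriv (η x) η x) w - dirDeriv w δ x / δ x) +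
      dirDeriv w (fun y => (Real.sqrt (φ y))⁻¹) x, ?_⟩
    rw [hξ, dirDeriv_smul H.isOpen hs hZ w hx, h1, smul_add, smul_smul, add_assoc, smul_smul,
      ← add_smul]
  have hξξ : ∀ y ∈ Ω, inner ℝ (ξ y) (ξ y) = (1 : ℝ) := fun y hy => by
    have hφy := H.pos y hy
    simp only [hξ, real_inner_smul_left, real_inner_smul_right, H.conformal y hy,
      H.inner_η_self hy]
    have := Real.mul_self_sqrt hφy.le
    have h0 := (Real.sqrt_pos.2 hφy).ne'
    field_simp
    rw [sq, this]
  have hξs : ContDiffOn ℝ ∞ ξ Ω := hs.smul hZ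
  have h3 := dirDeriv_inner H.isOpen hξs hξs w hx
  rw [dirDeriv_congr H.isOpen (k := fun _ => (1 : ℝ)) hξξ w hx, dirDeriv_const,
    real_inner_comm, hτ] at h3
  simp only [hξ, real_inner_smul_right, inner_add_left, real_inner_smul_left, H.conformal x hx,
    H.inner_η_self hx, real_inner_comm (η x) w, hw] at h3
  have h0 := (inv_pos.2 (Real.sqrt_pos.2 hφ)).ne'
  have hτ0 : τ = 0 := by
    have h4 : (Real.sqrt (φ x))⁻¹ * φ x ≠ 0 := mul_ne_zero h0 hφ.ne'
    refine (mul_eq_zero.1 (show ((Real.sqrt (φ x))⁻¹ * φ x) * τ = 0 by linarith)).resolve_left h4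
  rw [hτ, hτ0, zero_smul, add_zero]

/-- The factor of proportionality in `dirDeriv_unitDirection` is constant along the curvature
leaves. -/
theorem dirDeriv_unitDirection_factor (hx : x ∈ Ω) {w : E} (hw : inner ℝ (η x) w = 0) :
    dirDeriv w (fun y => (Real.sqrt (φ y))⁻¹ * (dirDeriv (η y) κ y / δ y)) x = 0 := by
  set ξ := fun y => (Real.sqrt (φ y))⁻¹ • dirDeriv (η y) F y with hξ
  set ρ := fun y => (Real.sqrt (φ y))⁻¹ * (dirDeriv (η y) κ y / δ y) with hρ
  have hs : ContDiffOn ℝ ∞ (fun y => (Real.sqrt (φ y))⁻¹) Ω :=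
    (H.smooth_factor.sqrt fun y hy => (H.pos y hy).ne').inv
      fun y hy => (Real.sqrt_pos.2 (H.pos y hy)).ne'
  have hξs : ContDiffOn ℝ ∞ ξ Ω := hs.smul (H.smooth_along H.smooth)
  have hρs : ContDiffOn ℝ ∞ ρ Ω := hs.mul ((H.smooth_along H.smooth_κ).div H.smooth_δ H.δ_ne_zero)
  -- With this `Y`, the identity `dξ = ρ dF + ⟪η, ·⟫ Y` holds in every direction. So `ξ`, `ρ`
  -- satisfy an equation of the same form as `-N`, `κ`, and the argument for `κ` can be repeated.
  set Y := fun y => dirDeriv (η y) ξ y - ρ y • dirDeriv (η y) F y with hY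
  have hYs : ContDiffOn ℝ ∞ Y Ω := (H.smooth_along hξs).sub (hρs.smul (H.smooth_along H.smooth))
  obtain ⟨v, hv, hηv, hwv⟩ := exists_unit_orthogonal_pair hdim (η x) w
  have h := dirDeriv_antisymm H.isOpen H.smooth hξs hYs hρs H.smooth_η (fun y hy u => by
    set t : ℝ := inner ℝ (η y) u with ht
    have hu : u = (u - t • η y) + t • η y := by abel
    have hperp : inner ℝ (η y) (u - t • η y) = 0 := by
      rw [inner_sub_right, real_inner_smul_right, H.inner_η_self hy, ht]; ring
    have h1 := H.dirDeriv_unitDirection hdim hy hperp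
    have h2 : dirDeriv u ξ y = dirDeriv (u - t • η y) ξ y + t • dirDeriv (η y) ξ y := by
      conv_lhs => rw [hu, dirDeriv_add_left, dirDeriv_smul_left]
    have h3 : dirDeriv (u - t • η y) F y = dirDeriv u F y - t • dirDeriv (η y) F y := by
      simp [dirDeriv]
    rw [h2, h1, h3, smul_sub, hY]
    simp only [hρ, smul_sub]
    rw [smul_comm t]
    abel) hx v w
  -- Nothing is known about the direction of `Y`; integrability of the leaves makes its two
  -- coefficients equal, so it drops out.
  rw [hηv, hw, H.inner_dirDeriv_η_comm hdim hx hηv hw, zero_smul, zero_smul, add_zero, add_zero,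
    add_left_inj] at h
  have h := congrArg (fun X => inner ℝ X (dirDeriv v F x)) h
  simp only [real_inner_smul_left, H.conformal x hx, hwv, real_inner_self_eq_norm_sq, hv] at h
  simpa [(H.pos x hx).ne'] using h

end IsPrincipal

end StructureEquations

/-! ### The spherical generators -/

section Spheres

variable {E E' : Type*} [NormedAddCommGroup E] [InnerProductSpace ℝ E]
  [NormedAddCommGroup E'] [InnerProductSpace ℝ E']

/-- The curvature leaves of a hypersurface of principal curvatures `κ ≠ 0` (of multiplicity
`n - 1`) and `κ + δ` lie on spheres of codimension two; the spheres and the points through which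
the normals pass are constant along the leaves. The spheres are not stationary across them. -/
theorem IsPrincipal.exists_spheres [FiniteDimensional ℝ E] {Ω : Set E} {F N : E → E'}
    {φ κ δ : E → ℝ} {η : E → E} (H : IsPrincipal Ω F N φ κ δ η)
    (hdim : 3 ≤ Module.finrank ℝ E) (hκ : ∀ x ∈ Ω, κ x ≠ 0) :
    ∃ (z c ν : E → E') (r : E → ℝ),
      ContDiffOn ℝ ∞ z Ω ∧ ContDiffOn ℝ ∞ c Ω ∧ ContDiffOn ℝ ∞ ν Ω ∧ ContDiffOn ℝ ∞ r Ω ∧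
      (∀ x ∈ Ω, ‖ν x‖ = 1 ∧ 0 < r x ∧ ‖F x - c x‖ = r x ∧ inner ℝ (F x - c x) (ν x) = 0 ∧
        ∀ v : E, inner ℝ (F x - z x) (dirDeriv v F x) = 0) ∧
      (∀ x ∈ Ω, ∀ w : E, inner ℝ (η x) w = 0 →
        dirDeriv w z x = 0 ∧ dirDeriv w c x = 0 ∧ dirDeriv w ν x = 0 ∧ dirDeriv w r x = 0) ∧
      ∀ x ∈ Ω, dirDeriv (η x) c x ≠ 0 ∨ dirDeriv (η x) ν x ≠ 0 := by
  set ξ := fun y => (Real.sqrt (φ y))⁻¹ • dirDeriv (η y) F y with hξ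
  set ρ := fun y => (Real.sqrt (φ y))⁻¹ * (dirDeriv (η y) κ y / δ y) with hρ
  have hs : ContDiffOn ℝ ∞ (fun y => (Real.sqrt (φ y))⁻¹) Ω :=
    (H.smooth_factor.sqrt fun y hy => (H.pos y hy).ne').inv
      fun y hy => (Real.sqrt_pos.2 (H.pos y hy)).ne'
  have hξs : ContDiffOn ℝ ∞ ξ Ω := hs.smul (H.smooth_along H.smooth)
  have hρs : ContDiffOn ℝ ∞ ρ Ω := hs.mul ((H.smooth_along H.smooth_κ).div H.smooth_δ H.δ_ne_zero)
  have hpos : ∀ y ∈ Ω, 0 < κ y ^ 2 + ρ y ^ 2 := fun y hy => by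
    have := pow_pos (abs_pos.2 (hκ y hy)) 2
    rw [sq_abs] at this
    nlinarith [sq_nonneg (ρ y)]
  have hNN : ∀ y ∈ Ω, inner ℝ (N y) (N y) = (1 : ℝ) := fun y hy => by
    rw [real_inner_self_eq_norm_sq, H.norm_normal y hy]; norm_num
  have hNξ : ∀ y ∈ Ω, inner ℝ (N y) (ξ y) = (0 : ℝ) := fun y hy => by
    simp only [hξ, real_inner_smul_right, H.inner_normal y hy, mul_zero]
  have hξN : ∀ y ∈ Ω, inner ℝ (ξ y) (N y) = (0 : ℝ) := fun y hy => by
    rw [real_inner_comm, hNξ y hy]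
  have hξξ : ∀ y ∈ Ω, inner ℝ (ξ y) (ξ y) = (1 : ℝ) := fun y hy => by
    have hφy := H.pos y hy
    simp only [hξ, real_inner_smul_left, real_inner_smul_right, H.conformal y hy,
      H.inner_η_self hy]
    have := Real.mul_self_sqrt hφy.le
    have h0 := (Real.sqrt_pos.2 hφy).ne'
    field_simp
    rw [sq, this]
  -- smoothness and constancy of functions of the two curvatures
  have hcomp : ∀ g : ℝ × ℝ → ℝ, ContDiffOn ℝ ∞ g {p | 0 < p.1 ^ 2 + p.2 ^ 2} →
      ContDiffOn ℝ ∞ (fun y => g (κ y, ρ y)) Ω ∧ ∀ x ∈ Ω, ∀ w : E, inner ℝ (η x) w = 0 →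
        dirDeriv w (fun y => g (κ y, ρ y)) x = 0 := by
    intro g hg
    have ho : IsOpen {p : ℝ × ℝ | 0 < p.1 ^ 2 + p.2 ^ 2} :=
      isOpen_lt continuous_const (by fun_prop)
    refine ⟨hg.comp (H.smooth_κ.prodMk hρs) fun y hy => hpos y hy, fun x hx w hw => ?_⟩
    exact dirDeriv_comp_pair_eq_zero (differentiableAt_of_contDiffOn H.isOpen H.smooth_κ hx)
      (differentiableAt_of_contDiffOn H.isOpen hρs hx)
      (differentiableAt_of_contDiffOn ho hg (hpos x hx)) (H.dirDeriv_κ hdim hx hw)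
      (H.dirDeriv_unitDirection_factor hdim hx hw)
  have hsq : ContDiffOn ℝ ∞ (fun p : ℝ × ℝ => p.1 ^ 2 + p.2 ^ 2) {p | 0 < p.1 ^ 2 + p.2 ^ 2} := by
    fun_prop
  have hrt : ContDiffOn ℝ ∞ (fun p : ℝ × ℝ => (Real.sqrt (p.1 ^ 2 + p.2 ^ 2))⁻¹)
      {p | 0 < p.1 ^ 2 + p.2 ^ 2} :=
    (hsq.sqrt fun p hp => (show 0 < p.1 ^ 2 + p.2 ^ 2 from hp).ne').inv
      fun p hp => (Real.sqrt_pos.2 hp).ne'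
  obtain ⟨hrs, hr0⟩ := hcomp _ hrt
  obtain ⟨has, ha0⟩ := hcomp (fun p => p.1 * (Real.sqrt (p.1 ^ 2 + p.2 ^ 2))⁻¹)
    (contDiffOn_fst.mul hrt)
  obtain ⟨hbs, hb0⟩ := hcomp (fun p => p.2 * (Real.sqrt (p.1 ^ 2 + p.2 ^ 2))⁻¹)
    (contDiffOn_snd.mul hrt)
  obtain ⟨hAs, hA0⟩ := hcomp (fun p => p.1 * (Real.sqrt (p.1 ^ 2 + p.2 ^ 2))⁻¹ ^ 2)
    (contDiffOn_fst.mul (hrt.pow 2))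
  obtain ⟨hBs, hB0⟩ := hcomp (fun p => -(p.2 * (Real.sqrt (p.1 ^ 2 + p.2 ^ 2))⁻¹ ^ 2))
    (contDiffOn_snd.mul (hrt.pow 2)).neg
  have his : ContDiffOn ℝ ∞ (fun y => (κ y)⁻¹) Ω := H.smooth_κ.inv hκ
  -- `hcomp` does not apply: the inverse of the first coordinate is not smooth on all of its domain,
  -- where that coordinate may vanish.
  have hi0 : ∀ x ∈ Ω, ∀ w : E, inner ℝ (η x) w = 0 → dirDeriv w (fun y => (κ y)⁻¹) x = 0 :=
    fun x hx w hw => by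
      have h := dirDeriv_comp_pair_eq_zero (g := fun p => p.1⁻¹)
        (differentiableAt_of_contDiffOn H.isOpen H.smooth_κ hx)
        (differentiableAt_of_contDiffOn H.isOpen H.smooth_κ hx)
        (differentiableAt_fst.inv (hκ x hx)) (H.dirDeriv_κ hdim hx hw) (H.dirDeriv_κ hdim hx hw)
      exact h
  set r := fun y => (Real.sqrt (κ y ^ 2 + ρ y ^ 2))⁻¹ with hr
  have hrpos : ∀ y ∈ Ω, 0 < r y := fun y hy => inv_pos.2 (Real.sqrt_pos.2 (hpos y hy))
  have hr2 : ∀ y ∈ Ω, r y ^ 2 * (κ y ^ 2 + ρ y ^ 2) = 1 := fun y hy => by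
    simp only [hr]
    rw [inv_pow, Real.sq_sqrt (hpos y hy).le, inv_mul_cancel₀ (hpos y hy).ne']
  -- Along a leaf `dN = -κ dF` and `dξ = ρ dF` with `κ`, `ρ` constant. Hence `F + α N + β ξ` is
  -- stationary iff `α κ - β ρ = 1`: `z` is the solution on the normal line, `c` the one nearest to
  -- `F`. The vector `ρ N + κ ξ` is stationary too, is orthogonal to `F - c`, and has length `1 /
  -- r`.
  set z := fun y => F y + (κ y)⁻¹ • N y with hz
  set c := fun y => F y + ((κ y * r y ^ 2) • N y + (-(ρ y * r y ^ 2)) • ξ y) with hc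
  set ν := fun y => (ρ y * r y) • N y + (κ y * r y) • ξ y with hν
  have hzs : ContDiffOn ℝ ∞ z Ω := H.smooth.add (his.smul H.smooth_normal)
  have hcs : ContDiffOn ℝ ∞ c Ω := H.smooth.add ((hAs.smul H.smooth_normal).add (hBs.smul hξs))
  have hνs : ContDiffOn ℝ ∞ ν Ω := (hbs.smul H.smooth_normal).add (has.smul hξs)
  have hperp : ∀ y ∈ Ω, inner ℝ (F y - c y) (ν y) = (0 : ℝ) := fun y hy => by
    simp only [hc, hν, sub_add_cancel_left, inner_neg_left, inner_add_left, inner_add_right,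
      real_inner_smul_left, real_inner_smul_right, hNN y hy, hNξ y hy, hξN y hy, hξξ y hy]
    ring
  refine ⟨z, c, ν, r, hzs, hcs, hνs, hrs, fun y hy => ⟨?_, hrpos y hy, ?_, hperp y hy, fun v => ?_⟩,
    fun x hx w hw => ?_, fun x hx => ?_⟩
  · rw [← sq_eq_sq₀ (norm_nonneg _) zero_le_one, ← real_inner_self_eq_norm_sq]
    simp only [hν, inner_add_left, inner_add_right,
      real_inner_smul_left, real_inner_smul_right, hNN y hy, hNξ y hy, hξN y hy, hξξ y hy]
    linear_combination hr2 y hy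
  · rw [← sq_eq_sq₀ (norm_nonneg _) (hrpos y hy).le, ← real_inner_self_eq_norm_sq]
    simp only [hc, sub_add_cancel_left, inner_neg_left, inner_neg_right, inner_add_left,
      inner_add_right,
      real_inner_smul_left, real_inner_smul_right, hNN y hy, hNξ y hy, hξN y hy, hξξ y hy]
    linear_combination r y ^ 2 * hr2 y hy
  · simp only [hz, sub_add_cancel_left, inner_neg_left, real_inner_smul_left,
      H.inner_normal y hy, mul_zero, neg_zero]
  · have hN : dirDeriv w N x = -(κ x • dirDeriv w F x) := by
      rw [H.dirDeriv_normal x hx, hw]; simp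
    have hξw : dirDeriv w ξ x = ρ x • dirDeriv w F x := H.dirDeriv_unitDirection hdim hx hw
    have hNc : ∀ {g : E → ℝ}, ContDiffOn ℝ ∞ g Ω → dirDeriv w g x = 0 →
        dirDeriv w (fun y => g y • N y) x = (-(g x * κ x)) • dirDeriv w F x := fun hg hg0 => by
      rw [dirDeriv_smul H.isOpen hg H.smooth_normal w hx, hg0, hN]; module
    have hξc : ∀ {g : E → ℝ}, ContDiffOn ℝ ∞ g Ω → dirDeriv w g x = 0 →
        dirDeriv w (fun y => g y • ξ y) x = (g x * ρ x) • dirDeriv w F x := fun hg hg0 => by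
      rw [dirDeriv_smul H.isOpen hg hξs w hx, hg0, hξw]; module
    refine ⟨?_, ?_, ?_, hr0 x hx w hw⟩
    · rw [hz, dirDeriv_add (k := fun y => (κ y)⁻¹ • N y) H.isOpen H.smooth
        (his.smul H.smooth_normal) w hx, hNc his (hi0 x hx w hw), inv_mul_cancel₀ (hκ x hx)]
      module
    · rw [hc, dirDeriv_add (k := fun y => (κ y * r y ^ 2) • N y + (-(ρ y * r y ^ 2)) • ξ y) H.isOpen
        H.smooth ((hAs.smul H.smooth_normal).add (hBs.smul hξs)) w hx,
        dirDeriv_add (g := fun y => (κ y * r y ^ 2) • N y)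
          (k := fun y => (-(ρ y * r y ^ 2)) • ξ y) H.isOpen (hAs.smul H.smooth_normal)
          (hBs.smul hξs) w hx, hNc hAs (hA0 x hx w hw), hξc hBs (hB0 x hx w hw), ← add_smul]
      have : -(κ x * r x ^ 2 * κ x) + -(ρ x * r x ^ 2) * ρ x = -1 := by
        linear_combination -(hr2 x hx)
      rw [this]; module
    · rw [hν, dirDeriv_add (g := fun y => (ρ y * r y) • N y) (k := fun y => (κ y * r y) • ξ y)
        H.isOpen (hbs.smul H.smooth_normal) (has.smul hξs) w hx, hNc hbs (hb0 x hx w hw),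
        hξc has (ha0 x hx w hw)]
      module
  -- If neither `c` nor `ν` moved in the direction `η`, differentiating `⟪F - c, ν⟫ = 0` would give
  -- `⟪dF η, ν⟫ = 0`, but this inner product is `κ r √φ ≠ 0`.
  · by_contra! hcon
    obtain ⟨h1, h2⟩ := hcon
    have h := dirDeriv_inner H.isOpen (H.smooth.sub hcs) hνs (η x) hx
    have h3 : dirDeriv (η x) (fun y => F y - c y) x = dirDeriv (η x) F x := by
      have h4 : dirDeriv (η x) (fun y => F y - c y) x = dirDeriv (η x) F x - dirDeriv (η x) c x := by
        unfold dirDeriv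
        rw [fderiv_fun_sub (differentiableAt_of_contDiffOn H.isOpen H.smooth hx)
          (differentiableAt_of_contDiffOn H.isOpen hcs hx)]
        simp
      rw [h4, h1, sub_zero]
    rw [dirDeriv_congr H.isOpen (k := fun _ => (0 : ℝ)) (fun y hy => hperp y hy) _ hx,
      dirDeriv_const, h2, h3, inner_zero_right, zero_add] at h
    simp only [hν, hξ, inner_add_right, real_inner_smul_right, H.conformal x hx,
      H.inner_η_self hx] at h
    rw [real_inner_comm, H.inner_normal x hx] at h
    have h5 := mul_ne_zero (mul_ne_zero (hκ x hx) (hrpos x hx).ne')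
      (mul_ne_zero (inv_pos.2 (Real.sqrt_pos.2 (H.pos x hx))).ne'
        (mul_ne_zero (H.pos x hx).ne' one_ne_zero))
    exact h5 (by linarith)

end Spheres

/-! ### Functions constant on the level sets of a submersion -/

section Factorization

variable {E : Type*} [NormedAddCommGroup E] [InnerProductSpace ℝ E] [FiniteDimensional ℝ E]

/-- Near a regular point of `σ`, smooth maps whose derivatives vanish on `ker dσ` are functions of
`σ`, in a way that is described by a smooth curve transversal to the level sets. -/
theorem exists_factorization {W : Set E} {σ : E → ℝ} {x : E} (hW : IsOpen W)
    (hσ : ContDiffOn ℝ ∞ σ W) (hx : x ∈ W) {e : E} (he : ‖e‖ = 1) (hxe : fderiv ℝ σ x e ≠ 0) :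
    ∃ (U : Set E) (a b : ℝ) (γ : ℝ → E), IsOpen U ∧ x ∈ U ∧ U ⊆ W ∧ σ '' U = Ioo a b ∧
      ContDiffOn ℝ ∞ γ (Ioo a b) ∧ MapsTo γ (Ioo a b) U ∧ (∀ y ∈ U, fderiv ℝ σ y ≠ 0) ∧
      ∀ {G : Type} [NormedAddCommGroup G] [NormedSpace ℝ G] (g : E → G), ContDiffOn ℝ ∞ g W →
        (∀ y ∈ W, ∀ v, fderiv ℝ σ y v = 0 → fderiv ℝ g y v = 0) →
        ∀ y ∈ U, g y = g (γ (σ y)) := by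
  have : CompleteSpace E := FiniteDimensional.complete ℝ E
  have hee : inner ℝ e e = (1 : ℝ) := by rw [real_inner_self_eq_norm_sq, he]; norm_num
  set W₁ : Set E := W ∩ (fun y => fderiv ℝ σ y e) ⁻¹' {0}ᶜ with hW₁
  have hW₁o : IsOpen W₁ := (contDiffOn_dirDeriv hW hσ e).continuousOn.isOpen_inter_preimage hW
    isOpen_compl_singleton
  -- The change of coordinates that replaces the coordinate along `e` by `σ`. It is a local
  -- diffeomorphism where `dσ e ≠ 0`, and turns level sets of `σ` into parallel hyperplanes.
  set G : E → E := fun y => y + (σ y - inner ℝ e y) • e with hG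
  have hGs : ContDiffOn ℝ ∞ G W := contDiffOn_id.add
    ((hσ.sub (contDiffOn_const.inner ℝ contDiffOn_id)).smul contDiffOn_const)
  have hGe : ∀ y, inner ℝ e (G y) = σ y := fun y => by
    simp only [hG, inner_add_right, real_inner_smul_right, hee]; ring
  have hder : ∀ y ∈ W₁, ∃ A : E ≃L[ℝ] E, HasFDerivAt G (A : E →L[ℝ] E) y ∧
      ∀ v, inner ℝ e (A v) = fderiv ℝ σ y v := by
    intro y hy
    set L : E →L[ℝ] E := ContinuousLinearMap.id ℝ E +
      (fderiv ℝ σ y - innerSL ℝ e).smulRight e with hL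
    have hσy := (differentiableAt_of_contDiffOn hW hσ hy.1).hasFDerivAt
    have hGL : HasFDerivAt G L y :=
      (hasFDerivAt_id y).add ((hσy.sub (innerSL ℝ e).hasFDerivAt).smul_const e)
    have hLe : ∀ v, inner ℝ e (L v) = fderiv ℝ σ y v := fun v => by
      simp [hL, inner_add_right, real_inner_smul_right, he]
    have hinj : Function.Injective (L : E →ₗ[ℝ] E) := by
      rw [← LinearMap.ker_eq_bot, LinearMap.ker_eq_bot']
      intro v hv
      have hv' : v + (fderiv ℝ σ y v - inner ℝ e v) • e = 0 := by simpa [hL] using hv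
      have h0 : fderiv ℝ σ y v = 0 := by
        rw [← hLe v, show L v = 0 from hv, inner_zero_right]
      have hve : v = (inner ℝ e v : ℝ) • e := by
        rw [h0, zero_sub, neg_smul, ← sub_eq_add_neg] at hv'
        exact sub_eq_zero.1 hv'
      rw [hve, map_smul, smul_eq_mul] at h0
      rw [hve, (mul_eq_zero.1 h0).resolve_right hy.2, zero_smul]
    refine ⟨(LinearEquiv.ofInjectiveEndo (L : E →ₗ[ℝ] E) hinj).toContinuousLinearEquiv, ?_, hLe⟩
    convert hGL
    ext v
    rfl
  obtain ⟨A, hA, -⟩ := hder x ⟨hx, hxe⟩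
  set Φ₀ := (hGs.contDiffAt (hW.mem_nhds hx)).toOpenPartialHomeomorph G hA (by simp) with hΦ₀
  set Φ := Φ₀.restrOpen W₁ hW₁o with hΦ
  have hΦG : ∀ y, Φ y = G y := fun y => rfl
  have hΦs : Φ.source ⊆ W₁ := fun y hy => by
    rw [hΦ, Φ₀.restrOpen_source] at hy; exact hy.2
  have hxΦ : x ∈ Φ.source := by
    rw [hΦ, Φ₀.restrOpen_source]
    exact ⟨(hGs.contDiffAt (hW.mem_nhds hx)).mem_toOpenPartialHomeomorph_source hA (by simp),
      hx, hxe⟩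
  -- A ball in the new coordinates meets each hyperplane `σ = s` in a convex set, and its diameter
  -- along `e` meets each of these sections once. This gives the curve `γ` and the interval of
  -- half-length `ε`.
  obtain ⟨ε, hε, hball⟩ := Metric.isOpen_iff.1 Φ.open_target (Φ x) (Φ.map_source hxΦ)
  set B := Metric.ball (Φ x) ε with hB
  set U : Set E := Φ.source ∩ Φ ⁻¹' B with hU
  have hsymmU : MapsTo Φ.symm B U := fun u hu =>
    ⟨Φ.map_target (hball hu), by rw [mem_preimage, Φ.right_inv (hball hu)]; exact hu⟩
  have hUW : U ⊆ W₁ := fun y hy => hΦs hy.1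
  have hσsymm : ∀ u ∈ B, σ (Φ.symm u) = inner ℝ e u := fun u hu => by
    rw [← hGe, ← hΦG, Φ.right_inv (hball hu)]
  have hline : ∀ s ∈ Ioo (σ x - ε) (σ x + ε), Φ x + (s - σ x) • e ∈ B := fun s hs => by
    rw [hB, mem_ball_iff_norm, add_sub_cancel_left, norm_smul, he, mul_one, Real.norm_eq_abs,
      abs_lt]
    constructor <;> linarith [hs.1, hs.2]
  have hσU : ∀ y ∈ U, σ y ∈ Ioo (σ x - ε) (σ x + ε) := fun y hy => by
    have h1 : σ y - σ x = inner ℝ e (Φ y - Φ x) := by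
      rw [inner_sub_right, hΦG, hΦG, hGe, hGe]
    have h2 : |σ y - σ x| < ε := by
      rw [h1]
      refine (abs_real_inner_le_norm _ _).trans_lt ?_
      rw [he, one_mul]
      exact mem_ball_iff_norm.1 hy.2
    rw [abs_lt] at h2
    constructor <;> linarith [h2.1, h2.2]
  have hσline : ∀ s, inner ℝ e (Φ x + (s - σ x) • e) = s := fun s => by
    rw [inner_add_right, real_inner_smul_right, hee, hΦG, hGe]; ring
  refine ⟨U, σ x - ε, σ x + ε, fun s => Φ.symm (Φ x + (s - σ x) • e),
    Φ.isOpen_inter_preimage Metric.isOpen_ball, ⟨hxΦ, Metric.mem_ball_self hε⟩,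
    fun y hy => (hUW hy).1, ?_, ?_, fun s hs => hsymmU (hline s hs), fun y hy h0 => ?_, ?_⟩
  · refine Subset.antisymm (image_subset_iff.2 hσU) fun s hs =>
      ⟨_, hsymmU (hline s hs), ?_⟩
    rw [hσsymm _ (hline s hs), hσline]
  · intro s hs
    have hmem := hUW (hsymmU (hline s hs))
    obtain ⟨A', hA', -⟩ := hder _ hmem
    have h1 : ContDiffAt ℝ ∞ Φ.symm (Φ x + (s - σ x) • e) :=
      Φ.contDiffAt_symm (hball (hline s hs)) hA' (hGs.contDiffAt (hW.mem_nhds hmem.1))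
    have h2 : ContDiffAt ℝ ∞ (fun s : ℝ => Φ x + (s - σ x) • e) s := by fun_prop
    exact (h1.comp s h2).contDiffWithinAt
  · exact (hUW hy).2 (by simp [h0])
  · intro K _ _ g hg hg0 y hy
    set u₁ := Φ x + (σ y - σ x) • e with hu₁
    have hu₁B : u₁ ∈ B := hline _ (hσU y hy)
    set D := Φ y - u₁ with hD
    have hDe : inner ℝ e D = (0 : ℝ) := by
      rw [hD, inner_sub_right, hu₁, hσline, hΦG, hGe, sub_self]
    -- In the new coordinates `y` is joined to the point of `γ` at the same level by a segment
    -- orthogonal to `e`. Along it `σ` is constant, so `g` has zero derivative.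
    have hpath : ∀ t ∈ Icc (0 : ℝ) 1, u₁ + t • D ∈ B := fun t ht =>
      (convex_ball (Φ x) ε).add_smul_sub_mem hu₁B hy.2 ht
    have hd : ∀ t ∈ Icc (0 : ℝ) 1,
        HasDerivWithinAt (fun t : ℝ => g (Φ.symm (u₁ + t • D))) 0 (Icc 0 1) t := by
      intro t ht
      have hmem := hUW (hsymmU (hpath t ht))
      obtain ⟨A', hA', hA'e⟩ := hder _ hmem
      have h1 := Φ.hasFDerivAt_symm (hball (hpath t ht)) hA'
      have h2 := (differentiableAt_of_contDiffOn hW hg hmem.1).hasFDerivAt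
      have h3 : HasDerivAt (fun t : ℝ => u₁ + t • D) D t := by
        simpa using ((hasDerivAt_id t).smul_const D).const_add u₁
      have h4 := ((h2.comp _ h1).comp_hasDerivAt t h3).hasDerivWithinAt (s := Icc 0 1)
      have h5 : fderiv ℝ g (Φ.symm (u₁ + t • D)) (A'.symm D) = 0 := by
        refine hg0 _ hmem.1 _ ?_
        rw [← hA'e, A'.apply_symm_apply, hDe]
      exact h4.congr_deriv h5
    have hb := (convex_Icc (0 : ℝ) 1).norm_image_sub_le_of_norm_hasDerivWithin_le hd
      (C := 0) (fun t _ => by simp) (left_mem_Icc.2 zero_le_one) (right_mem_Icc.2 zero_le_one)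
    rw [zero_mul, norm_le_zero_iff, sub_eq_zero] at hb
    simp only [one_smul, zero_smul, add_zero, hD, add_sub_cancel] at hb
    rw [Φ.left_inv hy.1] at hb
    exact hb

end Factorization

/-! ### The theorem in conformal coordinates -/

section Local

/-- A conformally parametrized hypersurface has locally a smooth unit normal field. -/
theorem exists_isConformalHypersurface {E E' : Type*} [NormedAddCommGroup E]
    [InnerProductSpace ℝ E] [FiniteDimensional ℝ E] [NormedAddCommGroup E']
    [InnerProductSpace ℝ E'] [FiniteDimensional ℝ E']
    (hcodim : Module.finrank ℝ E' = Module.finrank ℝ E + 1) {Ω : Set E} {F : E → E'} {φ : E → ℝ}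
    (hΩ : IsOpen Ω) (hF : ContDiffOn ℝ ∞ F Ω) (hφ : ContDiffOn ℝ ∞ φ Ω) (hpos : ∀ x ∈ Ω, 0 < φ x)
    (hconf : ∀ x ∈ Ω, ∀ v w : E,
      inner ℝ (dirDeriv v F x) (dirDeriv w F x) = φ x * inner ℝ v w) {x : E} (hx : x ∈ Ω) :
    ∃ (W : Set E) (N : E → E'), x ∈ W ∧ W ⊆ Ω ∧ IsConformalHypersurface W F N φ := by
  have hfin : ∀ y ∈ Ω, Module.finrank ℝ (LinearMap.range (fderiv ℝ F y : E →ₗ[ℝ] E'))ᗮ = 1 := by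
    intro y hy
    have hinj : Function.Injective (fderiv ℝ F y : E →ₗ[ℝ] E') := by
      rw [← LinearMap.ker_eq_bot, LinearMap.ker_eq_bot']
      intro v hv
      have h := hconf y hy v v
      rw [show dirDeriv v F y = 0 from hv, inner_zero_left] at h
      exact inner_self_eq_zero.1 ((mul_eq_zero.1 h.symm).resolve_left (hpos y hy).ne')
    have h1 := LinearMap.finrank_range_of_inj hinj
    have h2 := (LinearMap.range (fderiv ℝ F y : E →ₗ[ℝ] E')).finrank_add_finrank_orthogonal
    omega
  have hmem : ∀ y (X : E'), X ∈ (LinearMap.range (fderiv ℝ F y : E →ₗ[ℝ] E'))ᗮ ↔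
      ∀ v, inner ℝ X (dirDeriv v F y) = 0 := fun y X => by
    rw [Submodule.mem_orthogonal']
    exact ⟨fun h v => h _ ⟨v, rfl⟩, by rintro h _ ⟨v, rfl⟩; exact h v⟩
  obtain ⟨N₀, hN₀, hN₀0⟩ : ∃ X ∈ (LinearMap.range (fderiv ℝ F x : E →ₗ[ℝ] E'))ᗮ, X ≠ 0 := by
    refine (Submodule.ne_bot_iff _).1 fun h => ?_
    have := hfin x hx
    rw [h, finrank_bot] at this
    omega
  rw [hmem] at hN₀
  set e := stdOrthonormalBasis ℝ E
  -- The component of the fixed vector `N₀` normal to the hypersurface at `y`: the vectors `dF (e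
  -- i)` divided by `√φ` form an orthonormal basis of the tangent space.
  set V : E → E' := fun y =>
    N₀ - (φ y)⁻¹ • ∑ i, (inner ℝ N₀ (dirDeriv (e i) F y) : ℝ) • dirDeriv (e i) F y with hV
  have hVs : ContDiffOn ℝ ∞ V Ω := by
    refine contDiffOn_const.sub ((hφ.inv fun y hy => (hpos y hy).ne').smul
      (ContDiffOn.sum fun i _ => ?_))
    have := contDiffOn_dirDeriv hΩ hF (e i)
    exact (contDiffOn_const.inner ℝ this).smul this
  have hVF : ∀ y ∈ Ω, ∀ v, inner ℝ (V y) (dirDeriv v F y) = 0 := fun y hy v => by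
    have h1 : dirDeriv v F y = ∑ i, (inner ℝ (e i) v : ℝ) • dirDeriv (e i) F y := by
      conv_lhs => rw [← e.sum_repr' v]
      simp [dirDeriv]
    have h2 : inner ℝ N₀ (dirDeriv v F y) =
        ∑ i, inner ℝ (e i) v * inner ℝ N₀ (dirDeriv (e i) F y) := by
      rw [h1, inner_sum]
      simp only [real_inner_smul_right]
    simp only [hV, inner_sub_left, real_inner_smul_left, sum_inner, hconf y hy, h2]
    rw [Finset.mul_sum, sub_eq_zero]
    refine Finset.sum_congr rfl fun i _ => ?_
    have := (hpos y hy).ne'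
    field_simp
  have hVx : V x = N₀ := by simp [hV, hN₀]
  have hWo : IsOpen (Ω ∩ V ⁻¹' {0}ᶜ) :=
    hVs.continuousOn.isOpen_inter_preimage hΩ isOpen_compl_singleton
  have hN1 : ∀ y ∈ Ω ∩ V ⁻¹' {0}ᶜ, ‖(‖V y‖)⁻¹ • V y‖ = 1 := fun y hy => norm_smul_inv_norm hy.2
  refine ⟨Ω ∩ V ⁻¹' {0}ᶜ, fun y => (‖V y‖)⁻¹ • V y, ⟨hx, by simpa [hVx] using hN₀0⟩,
    inter_subset_left, hWo, hF.mono inter_subset_left, ?_, hφ.mono inter_subset_left,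
    fun y hy => hpos y hy.1, fun y hy => hconf y hy.1, hN1, fun y hy v => ?_, fun y hy X hX => ?_⟩
  · have h := hVs.mono (inter_subset_left (t := V ⁻¹' {0}ᶜ))
    exact ((h.norm ℝ fun y hy => hy.2).inv fun y hy => norm_ne_zero_iff.2 hy.2).smul h
  · rw [real_inner_smul_left, hVF y hy.1, mul_zero]
  · set N := (‖V y‖)⁻¹ • V y with hN
    have hNF : N ∈ (LinearMap.range (fderiv ℝ F y : E →ₗ[ℝ] E'))ᗮ := by
      rw [hmem]
      intro v
      rw [hN, real_inner_smul_left, hVF y hy.1, mul_zero]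
    have hN0 : N ≠ 0 := fun h => by
      have := hN1 y hy
      rw [← hN, h, norm_zero] at this
      exact zero_ne_one this
    obtain ⟨t, ht⟩ := (finrank_eq_one_iff_of_nonzero' (⟨N, hNF⟩ :
      (LinearMap.range (fderiv ℝ F y : E →ₗ[ℝ] E'))ᗮ) (by simpa using hN0)).1 (hfin y hy.1)
      ⟨X, (hmem y X).2 hX⟩
    have ht' : t • N = X := congrArg Subtype.val ht
    rw [← ht', real_inner_smul_left, real_inner_self_eq_norm_sq, hN1 y hy]
    simp

/-- The local form of the theorem: a conformally parametrized hypersurface of dimension at least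
four without umbilical points is canal near every point where its second fundamental form has rank
at least two. -/
theorem IsConformalHypersurface.exists_canal {E E' : Type} [NormedAddCommGroup E]
    [InnerProductSpace ℝ E] [FiniteDimensional ℝ E] [NormedAddCommGroup E']
    [InnerProductSpace ℝ E'] [CompleteSpace E'] {Ω : Set E} {F N : E → E'} {φ : E → ℝ}
    (H : IsConformalHypersurface Ω F N φ) (hdim : 4 ≤ Module.finrank ℝ E)
    (humb : ∀ x ∈ Ω, ¬ ∃ c : ℝ, ∀ v w : E,
      - inner ℝ (dirDeriv v N x) (dirDeriv w F x) = c * inner ℝ v w) {x : E} (hx : x ∈ Ω)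
    (hrank : ¬ ∃ (β : ℝ) (ζ : E), ∀ v w : E,
      - inner ℝ (dirDeriv v N x) (dirDeriv w F x) = β * (inner ℝ ζ v * inner ℝ ζ w)) :
    ∃ (U : Set E) (a b : ℝ) (z c ν : ℝ → E') (r : ℝ → ℝ) (σ : E → ℝ),
      IsOpen U ∧ x ∈ U ∧ U ⊆ Ω ∧
      ContDiffOn ℝ ∞ z (Ioo a b) ∧ ContDiffOn ℝ ∞ c (Ioo a b) ∧
      ContDiffOn ℝ ∞ ν (Ioo a b) ∧ ContDiffOn ℝ ∞ r (Ioo a b) ∧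
      (∀ s ∈ Ioo a b, ‖ν s‖ = 1 ∧ 0 < r s) ∧
      ContDiffOn ℝ ∞ σ U ∧ σ '' U = Ioo a b ∧
      ∀ y ∈ U, fderiv ℝ σ y ≠ 0 ∧ F y ∈
        {X | ‖X - c (σ y)‖ = r (σ y) ∧ inner ℝ (X - c (σ y)) (ν (σ y)) = 0} ∧
        ∀ v : E, inner ℝ (F y - z (σ y)) (dirDeriv v F y) = 0 := by
  obtain ⟨W, κ, δ, η, hWo, hxW, hWΩ, hκs, hδs, hηs, hprin⟩ :=
    H.exists_smooth_principal hdim humb hx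
  -- If `κ` vanished, only the rank-one term of the second fundamental form would remain.
  have hκx : κ x ≠ 0 := fun h0 => hrank ⟨δ x * φ x, η x, fun v w => by
    rw [(hprin x hxW).2.2 v, h0, zero_smul, zero_add, inner_neg_left, neg_neg,
      real_inner_smul_left, H.conformal x hx]
    ring⟩
  set W₁ := W ∩ κ ⁻¹' {0}ᶜ with hW₁
  have hW₁W : W₁ ⊆ W := inter_subset_left
  have hW₁o : IsOpen W₁ := hκs.continuousOn.isOpen_inter_preimage hWo isOpen_compl_singleton
  have P : IsPrincipal W₁ F N φ κ δ η :=
    { H.mono hW₁o (hW₁W.trans hWΩ) with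
      smooth_κ := hκs.mono hW₁W
      smooth_δ := hδs.mono hW₁W
      smooth_η := hηs.mono hW₁W
      norm_η := fun y hy => (hprin y (hW₁W hy)).1
      δ_ne_zero := fun y hy => (hprin y (hW₁W hy)).2.1
      dirDeriv_normal := fun y hy => (hprin y (hW₁W hy)).2.2 }
  have hxW₁ : x ∈ W₁ := ⟨hxW, hκx⟩
  obtain ⟨z, c, ν, r, hzs, hcs, hνs, hrs, hsph, hconst, hne⟩ :=
    P.exists_spheres (by omega) fun y hy => hy.2
  obtain ⟨σ, hσs, hσc, hσx⟩ : ∃ σ : E → ℝ, ContDiffOn ℝ ∞ σ W₁ ∧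
      (∀ y ∈ W₁, ∀ w : E, inner ℝ (η y) w = 0 → dirDeriv w σ y = 0) ∧
      dirDeriv (η x) σ x ≠ 0 := by
    have key : ∀ g : E → E', ContDiffOn ℝ ∞ g W₁ →
        (∀ y ∈ W₁, ∀ w : E, inner ℝ (η y) w = 0 → dirDeriv w g y = 0) →
        dirDeriv (η x) g x ≠ 0 → ∃ σ : E → ℝ, ContDiffOn ℝ ∞ σ W₁ ∧
      (∀ y ∈ W₁, ∀ w : E, inner ℝ (η y) w = 0 → dirDeriv w σ y = 0) ∧
      dirDeriv (η x) σ x ≠ 0 := by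
      intro g hg hg0 hgx
      have hd : ∀ y ∈ W₁, ∀ w, dirDeriv w (fun y => (inner ℝ (g y) (dirDeriv (η x) g x) : ℝ)) y =
          inner ℝ (dirDeriv w g y) (dirDeriv (η x) g x) := fun y hy w => by
        rw [dirDeriv_inner hW₁o hg contDiffOn_const w hy, dirDeriv_const, inner_zero_right,
          zero_add]
      -- The component of `g` along its own velocity at `x`: its derivative there in the direction
      -- `η` is the squared length of that velocity.
      refine ⟨fun y => inner ℝ (g y) (dirDeriv (η x) g x), hg.inner ℝ contDiffOn_const,
        fun y hy w hw => ?_, ?_⟩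
      · rw [hd y hy, hg0 y hy w hw, inner_zero_left]
      · rw [hd x hxW₁]
        exact inner_self_ne_zero.2 hgx
    rcases hne x hxW₁ with h | h
    · exact key c hcs (fun y hy w hw => (hconst y hy w hw).2.1) h
    · exact key ν hνs (fun y hy w hw => (hconst y hy w hw).2.2.1) h
  -- On `W₂` the kernel of `dσ` is exactly the orthogonal complement of `η`, so data constant along
  -- the leaves factor through `σ`.
  set W₂ := W₁ ∩ (fun y => dirDeriv (η y) σ y) ⁻¹' {0}ᶜ with hW₂
  have hW₂W : W₂ ⊆ W₁ := inter_subset_left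
  have hW₂o : IsOpen W₂ :=
    (P.smooth_along hσs).continuousOn.isOpen_inter_preimage hW₁o isOpen_compl_singleton
  have hker : ∀ y ∈ W₂, ∀ v, fderiv ℝ σ y v = 0 → inner ℝ (η y) v = (0 : ℝ) := by
    intro y hy v hv
    set t : ℝ := inner ℝ (η y) v with ht
    have h1 : dirDeriv (v - t • η y) σ y = 0 := by
      refine hσc y (hW₂W hy) _ ?_
      rw [inner_sub_right, real_inner_smul_right, P.inner_η_self (hW₂W hy), ht]; ring
    have h2 : dirDeriv (v - t • η y) σ y = fderiv ℝ σ y v - t * dirDeriv (η y) σ y := by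
      simp [dirDeriv]
    rw [h1, hv, zero_sub, zero_eq_neg] at h2
    exact (mul_eq_zero.1 h2).resolve_right hy.2
  obtain ⟨U, a, b, γ, hUo, hxU, hUW, hσU, hγ, hγU, hσ0, hfac⟩ :=
    exists_factorization hW₂o (hσs.mono hW₂W) ⟨hxW₁, hσx⟩ (P.norm_η x hxW₁) hσx
  have hγW : MapsTo γ (Ioo a b) W₁ := fun s hs => hW₂W (hUW (hγU hs))
  have hz := hfac z (hzs.mono hW₂W) fun y hy v hv =>
    (hconst y (hW₂W hy) v (hker y hy v hv)).1
  have hc := hfac c (hcs.mono hW₂W) fun y hy v hv =>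
    (hconst y (hW₂W hy) v (hker y hy v hv)).2.1
  have hν := hfac ν (hνs.mono hW₂W) fun y hy v hv =>
    (hconst y (hW₂W hy) v (hker y hy v hv)).2.2.1
  have hr := hfac r (hrs.mono hW₂W) fun y hy v hv =>
    (hconst y (hW₂W hy) v (hker y hy v hv)).2.2.2
  refine ⟨U, a, b, z ∘ γ, c ∘ γ, ν ∘ γ, r ∘ γ, σ, hUo, hxU,
    hUW.trans (hW₂W.trans (hW₁W.trans hWΩ)), hzs.comp hγ hγW, hcs.comp hγ hγW, hνs.comp hγ hγW,
    hrs.comp hγ hγW, fun s hs => ⟨(hsph _ (hγW hs)).1, (hsph _ (hγW hs)).2.1⟩,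
    hσs.mono (hUW.trans hW₂W), hσU, fun y hy => ⟨hσ0 y hy, ?_⟩⟩
  have hy₁ := hW₂W (hUW hy)
  simp only [Function.comp_apply, mem_ofPred_eq, ← hz y hy, ← hc y hy, ← hν y hy, ← hr y hy]
  exact (hsph y hy₁).2.2.elim fun h1 h => ⟨⟨h1, h.1⟩, h.2⟩

end Local

/-! ### Passage between the manifold and a chart -/

section Charts

/-- The derivative of a function that is given in the coordinates of a chart. -/
theorem mfderiv_apply_of_eventuallyEq_comp {n : ℕ} {M : Type*} [TopologicalSpace M]
    [ChartedSpace (EuclideanSpace ℝ (Fin n)) M] {V : Type*} [NormedAddCommGroup V]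
    [NormedSpace ℝ V] {e : M → EuclideanSpace ℝ (Fin n)} {g : M → V}
    {k : EuclideanSpace ℝ (Fin n) → V} {q : M} (he : MDifferentiableAt (𝓡 n) (𝓡 n) e q)
    (hk : DifferentiableAt ℝ k (e q)) (hg : g =ᶠ[nhds q] k ∘ e) (v : TangentSpace (𝓡 n) q) :
    mfderiv (𝓡 n) 𝓘(ℝ, V) g q v =
      dirDeriv (E := EuclideanSpace ℝ (Fin n)) (mfderiv (𝓡 n) (𝓡 n) e q v) k (e q) := by
  have hk' : MDifferentiableAt (𝓡 n) 𝓘(ℝ, V) k (e q) := hk.mdifferentiableAt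
  rw [hg.mfderiv_eq, mfderiv_comp q hk' he, mfderiv_eq_fderiv]
  rfl

end Charts

end CanalHypersurface

end

/-! ### The theorem on the manifold -/

open CanalHypersurface in
theorem theorem5p3 {n : ℕ} (hn : 4 ≤ n) {M : Type*} [TopologicalSpace M]
    [ChartedSpace (EuclideanSpace ℝ (Fin n)) M] [IsManifold (𝓡 n) ∞ M]
    (f : M → EuclideanSpace ℝ (Fin (n + 1)))
    (hf : CanalHypersurface.IsHypersurface f)
    (hflat : CanalHypersurface.IsConformallyFlat f)
    (humb : ∀ p : M, ¬ CanalHypersurface.IsUmbilicalPoint f p) :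
    ∀ p : M, ¬ CanalHypersurface.IsRankLeOnePoint f p →
      ∃ U : Set M, IsOpen U ∧ p ∈ U ∧ CanalHypersurface.IsCanalHypersurfaceOn f U := by
  intro p hp
  obtain ⟨e, he, hpe, μ, hμ, hconf⟩ := hflat p
  have hes := contMDiffOn_of_mem_maximalAtlas he
  have hesymm := contMDiffOn_symm_of_mem_maximalAtlas he
  have heMD : e.MDifferentiable (𝓡 n) (𝓡 n) :=
    ⟨hes.mdifferentiableOn (by simp), hesymm.mdifferentiableOn (by simp)⟩
  set F := f ∘ e.symm with hF
  set φ := μ ∘ e.symm with hφ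
  have hFs : ContDiffOn ℝ ∞ F e.target :=
    (hf.1.comp_contMDiffOn hesymm).contDiffOn
  have hφs : ContDiffOn ℝ ∞ φ e.target :=
    (hμ.comp hesymm fun y hy => e.map_target hy).contDiffOn
  have hloc : ∀ {V : Type} (g : M → V), ∀ q ∈ e.source, g =ᶠ[nhds q] (g ∘ e.symm) ∘ e :=
    fun g q hq => (e.eventually_left_inverse hq).mono fun y hy => by
      simp only [Function.comp_apply, hy]
  have hdf : ∀ q ∈ e.source, ∀ v : TangentSpace (𝓡 n) q,
      differential (n := n) f q v = dirDeriv (differential (n := n) (k := n) e q v) F (e q) :=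
    fun q hq v => mfderiv_apply_of_eventuallyEq_comp (heMD.mdifferentiableAt hq)
      (differentiableAt_of_contDiffOn e.open_target hFs (e.map_source hq)) (hloc f q hq) v
  have hsurj : ∀ q ∈ e.source, ∀ v : EuclideanSpace ℝ (Fin n), ∃ v' : TangentSpace (𝓡 n) q,
      differential (n := n) (k := n) e q v' = v := fun q hq v => heMD.mfderiv_surjective hq v
  have hFconf : ∀ x ∈ e.target, ∀ v w : EuclideanSpace ℝ (Fin n),
      inner ℝ (dirDeriv v F x) (dirDeriv w F x) = φ x * inner ℝ v w := by
    intro x hx v w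
    have hq := e.map_target hx
    obtain ⟨v', rfl⟩ := hsurj _ hq v
    obtain ⟨w', rfl⟩ := hsurj _ hq w
    have h := (hconf _ hq).2 v' w'
    rw [inducedMetric, hdf _ hq, hdf _ hq, e.right_inv hx] at h
    exact h
  obtain ⟨W, N, hpW, hWe, H⟩ := exists_isConformalHypersurface (by simp) e.open_target hFs hφs
    (fun x hx => (hconf _ (e.map_target hx)).1) hFconf (e.map_source hpe)
  have hpre : ∀ {U : Set (EuclideanSpace ℝ (Fin n))}, IsOpen U → IsOpen (e.source ∩ e ⁻¹' U) :=
    fun hU => e.isOpen_inter_preimage hU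
  have hdN : ∀ q ∈ e.source ∩ e ⁻¹' W, ∀ v : TangentSpace (𝓡 n) q,
      differential (n := n) (N ∘ e) q v =
        dirDeriv (differential (n := n) (k := n) e q v) N (e q) :=
    fun q hq v => mfderiv_apply_of_eventuallyEq_comp (heMD.mdifferentiableAt hq.1)
      (differentiableAt_of_contDiffOn H.isOpen H.smooth_normal hq.2) Filter.EventuallyEq.rfl v
  have hnormal : ∀ q ∈ e.source ∩ e ⁻¹' W,
      IsUnitNormalNear f (N ∘ e) (e.source ∩ e ⁻¹' W) q := fun q hq =>
    ⟨hpre H.isOpen, hq, H.smooth_normal.contMDiffOn.comp (hes.mono inter_subset_left)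
      inter_subset_right, fun q' hq' => ⟨H.norm_normal _ hq'.2, fun v => by
        rw [hdf q' hq'.1]; exact H.inner_normal _ hq'.2 _⟩⟩
  have hsff : ∀ q ∈ e.source ∩ e ⁻¹' W, ∀ v w : TangentSpace (𝓡 n) q,
      secondFundamentalForm f (N ∘ e) q v w =
        - inner ℝ (dirDeriv (differential (n := n) (k := n) e q v) N (e q))
          (dirDeriv (differential (n := n) (k := n) e q w) F (e q)) := fun q hq v w => by
    rw [secondFundamentalForm, hdN q hq, hdf q hq.1]
  obtain ⟨U, a, b, z, c, ν, r, σ, hUo, hpU, hUW, hz, hc, hν, hr, hνr, hσ, hσU, hU⟩ :=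
    H.exists_canal (by simpa using hn) (fun x hx ⟨c, hc⟩ => by
      have hq : e.symm x ∈ e.source ∩ e ⁻¹' W :=
        ⟨e.map_target (hWe hx), by rw [mem_preimage, e.right_inv (hWe hx)]; exact hx⟩
      -- In the chart `c` is a factor relative to the Euclidean inner product; the induced metric is
      -- `φ` times it, whence the division.
      refine humb (e.symm x) ⟨_, _, hnormal _ hq, c / φ x, fun v w => ?_⟩
      rw [hsff _ hq, e.right_inv (hWe hx), hc, inducedMetric, hdf _ hq.1, hdf _ hq.1,
        e.right_inv (hWe hx), hFconf x (hWe hx)]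
      have := (H.pos x hx).ne'
      field_simp) hpW (fun ⟨β, ζ, hβ⟩ => by
      have hq : p ∈ e.source ∩ e ⁻¹' W := ⟨hpe, hpW⟩
      refine hp ⟨_, _, hnormal _ hq, β,
        (innerₛₗ ℝ ζ).comp (differential (n := n) (k := n) e p).toLinearMap, fun v w => ?_⟩
      rw [hsff _ hq, hβ]
      rfl)
  have hUe : U ⊆ e.target := hUW.trans hWe
  refine ⟨e.source ∩ e ⁻¹' U, hpre hUo, ⟨hpe, hpU⟩, a, b, z, c, ν, r, σ ∘ e, hz, hc, hν, hr, hνr,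
    hσ.contMDiffOn.comp (hes.mono inter_subset_left) inter_subset_right, ?_, fun q hq => ?_⟩
  · rw [image_comp, e.image_source_inter_eq', ← hσU]
    congr 1
    ext x
    exact ⟨fun h => by simpa [e.right_inv h.1] using h.2,
      fun h => ⟨hUe h, by simpa [e.right_inv (hUe h)] using h⟩⟩
  · obtain ⟨h1, h2, h3⟩ := hU _ hq.2
    have hFq : F (e q) = f q := by simp only [hF, Function.comp_apply, e.left_inv hq.1]
    rw [hFq] at h2 h3
    refine ⟨fun h0 => h1 ?_, h2, fun v => ?_⟩
    · ext v
      obtain ⟨v', rfl⟩ := hsurj q hq.1 v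
      have := mfderiv_apply_of_eventuallyEq_comp (g := σ ∘ e) (heMD.mdifferentiableAt hq.1)
        (differentiableAt_of_contDiffOn hUo hσ hq.2) Filter.EventuallyEq.rfl v'
      rw [h0] at this
      exact this.symm
    · rw [hdf q hq.1]
      exact h3 _
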